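/- Let $C\colon Y^2=F(X,Z)$ be a smooth projective curve of genus $2$ over $\mathbb C$ in the weighted projective plane $\mathbb P(1,3,1)$, where $F=f_0Z^6+f_1XZ^5+\dots+f_6X^6$ is a binary sextic form. Write $F=\prod_{i=0}^{5}(p_iX+q_iZ)$ with pairwise non-proportional linear forms; their zeros are the six ramification points of $C\to\mathbb P^1$. Let $J$ be the Jacobian of $C$, and let $\kappa\colon J(\mathbb C)\to\mathbb P^3(\mathbb C)$ be the standard (Cassels–Flynn) map onto the Kummer surface: for the point $P$ of $J(\mathbb C)$ given by $[(X_1:Y_1:Z_1)+(X_2:Y_2:Z_2)]-W$, with $W$ the canonical class, the first three coordinates of $\kappa(P)$ are $Z_1Z_2,\ X_1Z_2+X_2Z_1,\ X_1X_2$ and the fourth is $(F_0-2Y_1Y_2)/(X_1Z_2-X_2Z_1)^2$, where $F_0$ is the usual symmetric form of bidegree $(3,3)$ with $F_0=2F$ on the diagonal. Let $\delta=(\delta_1,\dots,\delta_4)$ be the duplication polynomials, homogeneous of degree $4$, with $\kappa(2P)=\delta(\kappa(P))$ and $\delta(0,0,0,1)=(0,0,0,1)$. With $\|\cdot\|$ the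 maximum norm (for the usual absolute value), put, for Kummer coordinates $x$ of $P$, $$\tilde\varepsilon(x)=-\log\|\delta(x)\|+4\log\|x\|,\qquad \tilde\mu(P)=\sum_{n\ge0}4^{-(n+1)}\,\tilde\varepsilon(\delta^{\circ n}(x)).$$ For each of the ten partitions $\{S,S'\}$ of the ramification points into two sets of three, let $G=\sum_k g_kX^kZ^{3-k}$ and $H=\sum_k h_kX^kZ^{3-k}$ be the corresponding products of linear forms, so $F=GH$, and set $$b_{\{S,S'\},1}=g_0h_2+g_2h_0,\quad b_{\{S,S'\},2}=g_0h_3+g_3h_0,\quad b_{\{S,S'\},3}=g_1h_3+g_3h_1,\quad b_{\{S,S'\},4}=1.$$ Let $y_{\{S,S'\}}$ be the explicit quadratic form in $x_1,\dots,x_4$, with coefficient $1$ at $x_4^2$, characterized by $y_{\{S,S'\}}(x)^2=\sum_{j}b_{\{S,S'\},j}\,\delta_j(x)$ for all Kummer coordinates $x$; and let $a_{i,\{S,S'\}}\in\mathbb C$ be the (explicit) coefficients in $x_i^2=\sum_{\{S,S'\}}a_{i,\{S,S'\}}\,y_{\{S,S'\}}(x)$. Define $\varphi\colon\mathbb R_{\ge0}^4\to\mathbb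 R_{\ge0}^4$ by $$\varphi_i(d)=\sqrt{\sum_{\{S,S'\}}|a_{i,\{S,S'\}}|\sqrt{\sum_{j=1}^4|b_{\{S,S'\},j}|\,d_j}}\qquad(1\le i\le4),$$ and a sequence by $b_0=(1,1,1,1)$, $b_{n+1}=\varphi(b_n)$. The two relations above hold for the explicit forms $y_{\{S,S'\}}$ and numbers $a,b$. The series defining $\tilde\mu(P)$ converges for all $P\in J(\mathbb C)$. The sequence $(b_n)$ converges to a limit $b$ with positive entries, and $$\tilde\mu(P)\le\frac{4^N}{4^N-1}\log\|b_N\|\qquad\text{for all }N\ge1\text{ and all }P\in J(\mathbb C).$$ In particular, $\sup\tilde\mu(J(\mathbb C))\le\log\|b\|$. -/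

import Mathlib

open Filter Topology

noncomputable section

namespace Genus2

/-! ### The curve `Y² = F(X, Z)` in the weighted projective plane with weights `1, 3, 1` -/

/-- The binary sextic form `F(X, Z) = f₀ Z⁶ + f₁ X Z⁵ + ⋯ + f₆ X⁶`. -/
def sextic (f : Fin 7 → ℂ) (X Z : ℂ) : ℂ :=
  ∑ i : Fin 7, f i * X ^ (i : ℕ) * Z ^ (6 - (i : ℕ))

/-- A complex point of the curve `Y² = F(X, Z)` in `ℙ(1, 3, 1)`, given by its unique
representative `(X, Y, Z)` that is normalized by `Z = 1` (affine points) or by `X = 1` and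
`Z = 0` (points at infinity). -/
@[ext]
structure CurvePoint (f : Fin 7 → ℂ) where
  X : ℂ
  Y : ℂ
  Z : ℂ
  on_curve : Y ^ 2 = sextic f X Z
  normalized : Z = 1 ∨ (X = 1 ∧ Z = 0)

/-- The hyperelliptic involution `(X : Y : Z) ↦ (X : -Y : Z)`. -/
def CurvePoint.inv {f : Fin 7 → ℂ} (P : CurvePoint f) : CurvePoint f :=
  ⟨P.X, -P.Y, P.Z, by rw [neg_sq]; exact P.on_curve, P.normalized⟩

theorem CurvePoint.inv_inv {f : Fin 7 → ℂ} (P : CurvePoint f) : P.inv.inv = P := by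
  ext <;> simp [CurvePoint.inv]

/-! ### The Jacobian and its map to `ℙ³` -/

/-- An effective divisor of degree two is canonical if it is of the form `(P) + (ι P)`, where
`ι` is the hyperelliptic involution. -/
def IsCanonicalDivisor {f : Fin 7 → ℂ} (D : Sym2 (CurvePoint f)) : Prop :=
  ∃ P : CurvePoint f, D = s(P, P.inv)

/-- Linear equivalence of effective divisors of degree two on a curve of genus two: two such
divisors are linearly equivalent if and only if they are equal or both canonical. -/
def linearEquivalence (f : Fin 7 → ℂ) : Setoid (Sym2 (CurvePoint f)) where
  r D E := D = E ∨ (IsCanonicalDivisor D ∧ IsCanonicalDivisor E)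
  iseqv :=
    { refl := fun _ => Or.inl rfl
      symm := by
        rintro D E (h | ⟨h, h'⟩)
        · exact Or.inl h.symm
        · exact Or.inr ⟨h', h⟩
      trans := by
        rintro D E G (rfl | ⟨h, h'⟩) (rfl | ⟨k, k'⟩)
        · exact Or.inl rfl
        · exact Or.inr ⟨k, k'⟩
        · exact Or.inr ⟨h, h'⟩
        · exact Or.inr ⟨h, k'⟩ }

/-- The set `J(ℂ)` of complex points of the Jacobian of the genus two curve `Y² = F(X, Z)`:
effective divisors of degree two up to linear equivalence.  The class of `D = (P) + (Q)` stands
for the point `[D] - W ∈ Pic⁰(C) = J(ℂ)`, where `W` is the canonical class; by Riemann-Roch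
each point of `J(ℂ)` arises from exactly one class.  The origin is the class of the canonical
divisors. -/
def Jacobian (f : Fin 7 → ℂ) : Type := Quotient (linearEquivalence f)

/-- The symmetric form of bidegree `(3, 3)` that restricts to `2 F` on the diagonal. -/
def polarForm (f : Fin 7 → ℂ) (X₁ Z₁ X₂ Z₂ : ℂ) : ℂ :=
  let u := Z₁ * Z₂
  let s := X₁ * Z₂ + X₂ * Z₁
  let t := X₁ * X₂
  2 * f 0 * u ^ 3 + f 1 * s * u ^ 2 + 2 * f 2 * t * u ^ 2 + f 3 * s * t * u
    + 2 * f 4 * t ^ 2 * u + f 5 * s * t ^ 2 + 2 * f 6 * t ^ 3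

/-- The constant term of the equation
`(x₂² - 4 x₁ x₃) x₄² + K₁(x₁, x₂, x₃) x₄ + K₀(x₁, x₂, x₃) = 0` of the Kummer surface. -/
def kummerConst (f : Fin 7 → ℂ) (x1 x2 x3 : ℂ) : ℂ :=
  (f 1 ^ 2 - 4 * f 0 * f 2) * x1 ^ 4 - 4 * f 0 * f 3 * x1 ^ 3 * x2
    - 2 * f 1 * f 3 * x1 ^ 3 * x3 - 4 * f 0 * f 4 * x1 ^ 2 * x2 ^ 2
    + 4 * (f 0 * f 5 - f 1 * f 4) * x1 ^ 2 * x2 * x3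
    + (f 3 ^ 2 + 2 * f 1 * f 5 - 4 * f 2 * f 4 - 4 * f 0 * f 6) * x1 ^ 2 * x3 ^ 2
    - 4 * f 0 * f 5 * x1 * x2 ^ 3 + 4 * (2 * f 0 * f 6 - f 1 * f 5) * x1 * x2 ^ 2 * x3
    + 4 * (f 1 * f 6 - f 2 * f 5) * x1 * x2 * x3 ^ 2 - 2 * f 3 * f 5 * x1 * x3 ^ 3
    - 4 * f 0 * f 6 * x2 ^ 4 - 4 * f 1 * f 6 * x2 ^ 3 * x3 - 4 * f 2 * f 6 * x2 ^ 2 * x3 ^ 2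
    - 4 * f 3 * f 6 * x2 * x3 ^ 3 + (f 5 ^ 2 - 4 * f 4 * f 6) * x3 ^ 4

open Classical in
/-- Kummer coordinates of the point `[(P) + (Q)] - W` of the Jacobian (Cassels-Flynn).  When
`Q = ι P` this is the origin; when `P = Q ≠ ι P` the last coordinate is the limit of the general
formula, in the form `K₀ / (F₀ + 2 Y₁ Y₂)`. -/
def pairCoords {f : Fin 7 → ℂ} (P Q : CurvePoint f) : Fin 4 → ℂ :=
  if Q = P.inv then ![0, 0, 0, 1]
  else if P = Q then
    ![P.Z ^ 2, 2 * P.X * P.Z, P.X ^ 2,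
      kummerConst f (P.Z ^ 2) (2 * P.X * P.Z) (P.X ^ 2) / (4 * P.Y ^ 2)]
  else
    ![P.Z * Q.Z, P.X * Q.Z + Q.X * P.Z, P.X * Q.X,
      (polarForm f P.X P.Z Q.X Q.Z - 2 * P.Y * Q.Y) / (P.X * Q.Z - Q.X * P.Z) ^ 2]

theorem pairCoords_inv {f : Fin 7 → ℂ} (P : CurvePoint f) :
    pairCoords P P.inv = ![0, 0, 0, 1] := by
  simp [pairCoords]

theorem pairCoords_comm {f : Fin 7 → ℂ} (P Q : CurvePoint f) :
    pairCoords P Q = pairCoords Q P := by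
  have h : Q = P.inv ↔ P = Q.inv := by
    constructor <;> (rintro h; rw [h, CurvePoint.inv_inv])
  unfold pairCoords
  by_cases h1 : Q = P.inv
  · rw [if_pos h1, if_pos (h.1 h1)]
  · rw [if_neg h1, if_neg (fun k => h1 (h.2 k))]
    by_cases h2 : P = Q
    · subst h2; rfl
    · rw [if_neg h2, if_neg (fun k => h2 k.symm)]
      have e : polarForm f P.X P.Z Q.X Q.Z = polarForm f Q.X Q.Z P.X P.Z := by
        simp only [polarForm]; ring
      have e' : (P.X * Q.Z - Q.X * P.Z) ^ 2 = (Q.X * P.Z - P.X * Q.Z) ^ 2 := by ring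
      rw [e, e', mul_comm P.Z, mul_comm P.X Q.X, add_comm (P.X * Q.Z), mul_right_comm 2 P.Y]

/-- A set of Kummer coordinates `(x₁, x₂, x₃, x₄)` for a point `P ∈ J(ℂ)`, that is, projective
coordinates of its image `κ(P)` on the Kummer surface in `ℙ³`. -/
def kummerCoords {f : Fin 7 → ℂ} (P : Jacobian f) : Fin 4 → ℂ :=
  Quotient.lift (s := linearEquivalence f)
    (Sym2.lift ⟨fun P Q : CurvePoint f => pairCoords P Q, pairCoords_comm⟩)
    (by
      rintro D E (rfl | ⟨⟨P, rfl⟩, ⟨Q, rfl⟩⟩)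
      · rfl
      · simp [pairCoords_inv])
    P

/-! ### The duplication map and the height correction functions -/

/-! The duplication polynomials `δ₁, δ₂, δ₃, δ₄`, homogeneous of degree four: the point `2P` has
Kummer coordinates `δ(x)` when `x` are Kummer coordinates for `P`.  They are determined by this
and by `δ(0, 0, 0, 1) = (0, 0, 0, 1)` up to adding multiples of the quartic form that defines the
Kummer surface.  The parts of degree zero in `x₄` are given first. -/

/-- The part of `δ₁` of degree zero in `x₄`. -/
def dupConst1 (f0 f1 f2 f3 f4 f5 f6 x1 x2 x3 : ℂ) : ℂ :=
    (-16*f0^2*f6 - 16*f0*f2*f4 + 4*f0*f3^2 + 4*f1^2*f4)*x1^4 + (-16*f0*f1*f6 - 32*f0*f2*f5 + 8*f1^2*f5)*x1^3*x2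
    + (32*f0*f2*f6 - 16*f0*f3*f5 - 16*f1^2*f6)*x1^3*x3 + (-64*f0*f2*f6 - 8*f0*f3*f5 + 12*f1^2*f6)*x1^2*x2^2
    + (-16*f0*f4*f5 - 16*f1*f2*f6 - 4*f1*f3*f5)*x1^2*x2*x3 + (-48*f0*f4*f6 + 16*f0*f5^2 + 24*f1*f3*f6
    - 8*f1*f4*f5 - 16*f2^2*f6)*x1^2*x3^2 - 32*f0*f3*f6*x1*x2^3 + (-16*f0*f5^2 - 24*f1*f3*f6)*x1*x2^2*x3
    + (-16*f0*f5*f6 - 8*f1*f5^2 - 16*f2*f3*f6)*x1*x2*x3^2 + (32*f0*f6^2 - 16*f1*f5*f6 - 8*f3^2*f6)*x1*x3^3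
    + (-16*f0*f4*f6 + 4*f0*f5^2)*x2^4 + (-16*f0*f5*f6 - 16*f1*f4*f6 + 4*f1*f5^2)*x2^3*x3 + (-48*f0*f6^2
    - 8*f1*f5*f6 - 16*f2*f4*f6 + 4*f2*f5^2)*x2^2*x3^2 + (-32*f1*f6^2 - 16*f3*f4*f6 + 4*f3*f5^2)*x2*x3^3
    + (-16*f2*f6^2 + 8*f3*f5*f6 - 16*f4^2*f6 + 4*f4*f5^2)*x3^4

/-- The part of `δ₂` of degree zero in `x₄`. -/
def dupConst2 (f0 f1 f2 f3 f4 f5 f6 x1 x2 x3 : ℂ) : ℂ :=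
    16*f0^2*f5*x1^4 + (32*f0^2*f6 + 16*f0*f1*f5)*x1^3*x2 + (-32*f0*f2*f5 + 16*f0*f3*f4 + 16*f1^2*f5
    - 4*f1*f3^2)*x1^3*x3 + (32*f0*f1*f6 + 4*f1^2*f5)*x1^2*x2^2 + (-64*f0*f2*f6 - 24*f0*f3*f5 + 32*f0*f4^2
    + 32*f1^2*f6 + 16*f1*f2*f5 - 8*f1*f3*f4)*x1^2*x2*x3 + (-16*f0*f3*f6 - 16*f1*f3*f5 + 16*f1*f4^2
    + 16*f2^2*f5 - 16*f2*f3*f4 + 4*f3^3)*x1^2*x3^2 + 8*f1^2*f6*x1*x2^3 + (-64*f0*f3*f6 + 32*f0*f4*f5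
    + 32*f1*f2*f6 - 4*f1*f3*f5)*x1*x2^2*x3 + (-64*f0*f4*f6 + 32*f0*f5^2 - 24*f1*f3*f6 + 16*f1*f4*f5
    + 32*f2^2*f6 - 8*f2*f3*f5)*x1*x2*x3^2 + (-32*f1*f4*f6 + 16*f1*f5^2 + 16*f2*f3*f6 - 4*f3^2*f5)*x1*x3^3
    + 8*f0*f5^2*x2^3*x3 + (32*f0*f5*f6 + 4*f1*f5^2)*x2^2*x3^2 + (32*f0*f6^2 + 16*f1*f5*f6)*x2*x3^3
    + 16*f1*f6^2*x3^4

/-- The part of `δ₃` of degree zero in `x₄`. -/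
def dupConst3 (f0 f1 f2 f3 f4 f5 f6 x1 x2 x3 : ℂ) : ℂ :=
    (-16*f0^2*f4 + 8*f0*f1*f3 - 16*f0*f2^2 + 4*f1^2*f2)*x1^4 + (-32*f0^2*f5 - 16*f0*f2*f3 + 4*f1^2*f3)*x1^3*x2
    + (32*f0^2*f6 - 16*f0*f1*f5 - 8*f0*f3^2)*x1^3*x3 + (-48*f0^2*f6 - 8*f0*f1*f5 - 16*f0*f2*f4
    + 4*f1^2*f4)*x1^2*x2^2 + (-16*f0*f1*f6 - 16*f0*f3*f4 - 8*f1^2*f5)*x1^2*x2*x3 + (-48*f0*f2*f6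
    + 24*f0*f3*f5 - 16*f0*f4^2 + 16*f1^2*f6 - 8*f1*f2*f5)*x1^2*x3^2 + (-16*f0*f1*f6 - 16*f0*f2*f5
    + 4*f1^2*f5)*x1*x2^3 + (-24*f0*f3*f5 - 16*f1^2*f6)*x1*x2^2*x3 + (-16*f0*f4*f5 - 16*f1*f2*f6
    - 4*f1*f3*f5)*x1*x2*x3^2 + (32*f0*f4*f6 - 16*f0*f5^2 - 16*f1*f3*f6)*x1*x3^3 + (-16*f0*f2*f6
    + 4*f1^2*f6)*x2^4 - 32*f0*f3*f6*x2^3*x3 + (-64*f0*f4*f6 + 12*f0*f5^2 - 8*f1*f3*f6)*x2^2*x3^2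
    + (-16*f0*f5*f6 - 32*f1*f4*f6 + 8*f1*f5^2)*x2*x3^3 + (-16*f0*f6^2 - 16*f2*f4*f6 + 4*f2*f5^2
    + 4*f3^2*f6)*x3^4

/-- The part of `δ₄` of degree zero in `x₄`. -/
def dupConst4 (f0 f1 f2 f3 f4 f5 f6 x1 x2 x3 : ℂ) : ℂ :=
    (-16*f0^2*f2*f6 - 16*f0^2*f3*f5 + 16*f0^2*f4^2 + 4*f0*f1^2*f6 + 8*f0*f1*f2*f5 - 8*f0*f1*f3*f4
    + 16*f0*f2^2*f4 - 4*f0*f2*f3^2 - 2*f1^3*f5 - 4*f1^2*f2*f4 + f1^2*f3^2)*x1^4 + (-64*f0^2*f3*f6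
    + 32*f0^2*f4*f5 + 32*f0*f1*f2*f6 - 16*f0*f1*f3*f5 + 32*f0*f2^2*f5 - 8*f1^3*f6 - 8*f1^2*f2*f5)*x1^3*x2
    + (-64*f0^2*f4*f6 + 32*f0^2*f5^2 + 16*f0*f2*f3*f5 - 4*f1^2*f3*f5)*x1^3*x3 + (16*f0^2*f5^2 - 24*f0*f1*f3*f6
    + 64*f0*f2^2*f6 + 8*f0*f2*f3*f5 - 16*f1^2*f2*f6 - 2*f1^2*f3*f5)*x1^2*x2^2 + (96*f0^2*f5*f6
    - 64*f0*f1*f4*f6 + 16*f0*f1*f5^2 + 64*f0*f2*f3*f6 + 8*f0*f3^2*f5 - 8*f1^2*f3*f6)*x1^2*x2*x3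
    + (32*f0^2*f6^2 + 16*f0*f1*f5*f6 + 64*f0*f2*f4*f6 - 32*f0*f2*f5^2 - 8*f0*f3^2*f6 + 8*f0*f3*f4*f5
    - 32*f1^2*f4*f6 + 12*f1^2*f5^2 + 8*f1*f2*f3*f6)*x1^2*x3^2 + (32*f0*f2*f3*f6 - 8*f1^2*f3*f6)*x1*x2^3
    + (128*f0^2*f6^2 + 48*f0*f3^2*f6)*x1*x2^2*x3 + (96*f0*f1*f6^2 - 64*f0*f2*f5*f6 + 64*f0*f3*f4*f6
    - 8*f0*f3*f5^2 + 16*f1^2*f5*f6 + 8*f1*f3^2*f6)*x1*x2*x3^2 + (-64*f0*f2*f6^2 + 32*f1^2*f6^2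
    + 16*f1*f3*f4*f6 - 4*f1*f3*f5^2)*x1*x3^3 + (-16*f0^2*f6^2 + 16*f0*f2*f4*f6 - 4*f0*f2*f5^2 - 4*f1^2*f4*f6
    + f1^2*f5^2)*x2^4 + (32*f0*f3*f4*f6 - 8*f0*f3*f5^2)*x2^3*x3 + (-24*f0*f3*f5*f6 + 64*f0*f4^2*f6
    - 16*f0*f4*f5^2 + 16*f1^2*f6^2 + 8*f1*f3*f4*f6 - 2*f1*f3*f5^2)*x2^2*x3^2 + (-64*f0*f3*f6^2
    + 32*f0*f4*f5*f6 - 8*f0*f5^3 + 32*f1*f2*f6^2 - 16*f1*f3*f5*f6 + 32*f1*f4^2*f6 - 8*f1*f4*f5^2)*x2*x3^3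
    + (-16*f0*f4*f6^2 + 4*f0*f5^2*f6 - 16*f1*f3*f6^2 + 8*f1*f4*f5*f6 - 2*f1*f5^3 + 16*f2^2*f6^2
    - 8*f2*f3*f5*f6 + 16*f2*f4^2*f6 - 4*f2*f4*f5^2 - 4*f3^2*f4*f6 + f3^2*f5^2)*x3^4

/-- The duplication polynomial `δ₁`. -/
def dup1 (f0 f1 f2 f3 f4 f5 f6 x1 x2 x3 x4 : ℂ) : ℂ :=
    4*x1*x4^3 + (4*f2*x1^2 - 4*f5*x2*x3 - 12*f6*x3^2)*x4^2 + ((-16*f0*f4 + 4*f1*f3)*x1^3 - 32*f0*f5*x1^2*x2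
    - 8*f1*f5*x1^2*x3 + (-48*f0*f6 - 4*f1*f5)*x1*x2^2 + (-24*f1*f6 - 8*f2*f5)*x1*x2*x3 + (-16*f2*f6
    - 4*f3*f5)*x1*x3^2 - 8*f1*f6*x2^3 - 16*f2*f6*x2^2*x3 - 24*f3*f6*x2*x3^2 + (-32*f4*f6 + 8*f5^2)*x3^3)*x4
    + dupConst1 f0 f1 f2 f3 f4 f5 f6 x1 x2 x3

/-- The duplication polynomial `δ₂`. -/
def dup2 (f0 f1 f2 f3 f4 f5 f6 x1 x2 x3 x4 : ℂ) : ℂ :=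
    4*x2*x4^3 + (4*f1*x1^2 + 8*f2*x1*x2 - 4*f3*x1*x3 + 4*f3*x2^2 + 8*f4*x2*x3 + 4*f5*x3^2)*x4^2
    + (8*f0*f3*x1^3 + (16*f0*f4 + 4*f1*f3)*x1^2*x2 + (-16*f0*f5 + 16*f1*f4 - 8*f2*f3)*x1^2*x3 + (8*f0*f5
    + 8*f1*f4)*x1*x2^2 + (-48*f0*f6 + 16*f1*f5 + 16*f2*f4 - 8*f3^2)*x1*x2*x3 + (-16*f1*f6 + 16*f2*f5
    - 8*f3*f4)*x1*x3^2 + 4*f1*f5*x2^3 + (8*f1*f6 + 8*f2*f5)*x2^2*x3 + (16*f2*f6 + 4*f3*f5)*x2*x3^2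
    + 8*f3*f6*x3^3)*x4
    + dupConst2 f0 f1 f2 f3 f4 f5 f6 x1 x2 x3

/-- The duplication polynomial `δ₃`. -/
def dup3 (f0 f1 f2 f3 f4 f5 f6 x1 x2 x3 x4 : ℂ) : ℂ :=
    4*x3*x4^3 + (-12*f0*x1^2 - 4*f1*x1*x2 + 4*f4*x3^2)*x4^2 + ((-32*f0*f2 + 8*f1^2)*x1^3 - 24*f0*f3*x1^2*x2
    + (-16*f0*f4 - 4*f1*f3)*x1^2*x3 - 16*f0*f4*x1*x2^2 + (-24*f0*f5 - 8*f1*f4)*x1*x2*x3 - 8*f1*f5*x1*x3^2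
    - 8*f0*f5*x2^3 + (-48*f0*f6 - 4*f1*f5)*x2^2*x3 - 32*f1*f6*x2*x3^2 + (-16*f2*f6 + 4*f3*f5)*x3^3)*x4
    + dupConst3 f0 f1 f2 f3 f4 f5 f6 x1 x2 x3

/-- The duplication polynomial `δ₄`. -/
def dup4 (f0 f1 f2 f3 f4 f5 f6 x1 x2 x3 x4 : ℂ) : ℂ :=
    x4^4 + (8*f0*f4*x1^2 + 8*f0*f5*x1*x2 - 16*f0*f6*x1*x3 + 16*f0*f6*x2^2 - 2*f1*f3*x1^2 + 8*f1*f6*x2*x3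
    + 8*f2*f6*x3^2 - 2*f3*f5*x3^2)*x4^2 + ((-32*f0^2*f6 + 32*f0*f2*f4 - 8*f0*f3^2 - 8*f1^2*f4)*x1^3
    + (-16*f0*f1*f6 + 48*f0*f2*f5 - 12*f1^2*f5)*x1^2*x2 + (16*f0*f3*f5 - 8*f1^2*f6)*x1^2*x3 + (64*f0*f2*f6
    + 8*f0*f3*f5 - 16*f1^2*f6)*x1*x2^2 + (64*f0*f3*f6 + 4*f1*f3*f5)*x1*x2*x3 + (-8*f0*f5^2 + 16*f1*f3*f6)*x1*x3^2
    + 16*f0*f3*f6*x2^3 + (64*f0*f4*f6 - 16*f0*f5^2 + 8*f1*f3*f6)*x2^2*x3 + (-16*f0*f5*f6 + 48*f1*f4*f6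
    - 12*f1*f5^2)*x2*x3^2 + (-32*f0*f6^2 + 32*f2*f4*f6 - 8*f2*f5^2 - 8*f3^2*f6)*x3^3)*x4
    + dupConst4 f0 f1 f2 f3 f4 f5 f6 x1 x2 x3

/-- The duplication map `x ↦ δ(x) = (δ₁(x), δ₂(x), δ₃(x), δ₄(x))` on Kummer coordinates. -/
def dup (f : Fin 7 → ℂ) (x : Fin 4 → ℂ) : Fin 4 → ℂ :=
  ![dup1 (f 0) (f 1) (f 2) (f 3) (f 4) (f 5) (f 6) (x 0) (x 1) (x 2) (x 3),
    dup2 (f 0) (f 1) (f 2) (f 3) (f 4) (f 5) (f 6) (x 0) (x 1) (x 2) (x 3),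
    dup3 (f 0) (f 1) (f 2) (f 3) (f 4) (f 5) (f 6) (x 0) (x 1) (x 2) (x 3),
    dup4 (f 0) (f 1) (f 2) (f 3) (f 4) (f 5) (f 6) (x 0) (x 1) (x 2) (x 3)]

theorem dup_origin (f : Fin 7 → ℂ) : dup f ![0, 0, 0, 1] = ![0, 0, 0, 1] := by
  simp [dup, dup1, dup2, dup3, dup4, dupConst1, dupConst2, dupConst3, dupConst4]

/-- `ε̃(x) = -log ‖δ(x)‖ + 4 log ‖x‖`; the norm on `Fin 4 → ℂ` is the maximum norm. -/
def epsTilde (f : Fin 7 → ℂ) (x : Fin 4 → ℂ) : ℝ :=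
  -Real.log ‖dup f x‖ + 4 * Real.log ‖x‖

/-- The `n`-th term `4⁻⁽ⁿ⁺¹⁾ ε̃(δ^{∘n}(x))` of the series defining `μ̃(x)`. -/
def muTerm (f : Fin 7 → ℂ) (x : Fin 4 → ℂ) (n : ℕ) : ℝ :=
  ((4 : ℝ) ^ (n + 1))⁻¹ * epsTilde f ((dup f)^[n] x)

/-- The local height correction function `μ̃` on `J(ℂ)`. -/
def muTilde {f : Fin 7 → ℂ} (P : Jacobian f) : ℝ :=
  ∑' n : ℕ, muTerm f (kummerCoords P) n

/-! ### The ten quadratic forms, the coefficients `a` and `b`, and the map `φ`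

The sextic is written as a product of six linear forms `p i * X + q i * Z`, which are indexed by
the six ramification points of the double cover of `ℙ¹`. -/

/-- The ten partitions `{S, S'}` of the six ramification points into two sets of three, each
represented by the block `S` that contains the point with index `0` (and `S' = Sᶜ`). -/
def partitions : Finset (Finset (Fin 6)) :=
  Finset.univ.filter fun S => S.card = 3 ∧ (0 : Fin 6) ∈ S

/-- The coefficient of `X ^ k * Z ^ (3 - k)` in the cubic form `∏ i ∈ S, (p i * X + q i * Z)`. -/
def cubicCoeff (p q : Fin 6 → ℂ) (S : Finset (Fin 6)) (k : ℕ) : ℂ :=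
  (∏ i ∈ S, (Polynomial.C (p i) * Polynomial.X + Polynomial.C (q i))).coeff k

/-- The resultant of the two cubic forms that belong to `S` and to its complement. -/
def resultant (p q : Fin 6 → ℂ) (S : Finset (Fin 6)) : ℂ :=
  ∏ i ∈ S, ∏ j ∈ Sᶜ, (p i * q j - p j * q i)

/-- The quadratic form `y_{S,S'}` attached to a factorization `F = G H` into cubic forms with
coefficients `g k` and `h k`; it is symmetric in `G` and `H`, and it is normalized so that
`x₄²` has coefficient `1`. -/
def quadForm (g h : ℕ → ℂ) (x : Fin 4 → ℂ) : ℂ :=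
  x 3 ^ 2
  + 2 * x 3 * ((g 0 * h 2 + g 2 * h 0) * x 0 + (g 0 * h 3 + g 3 * h 0) * x 1
      + (g 1 * h 3 + g 3 * h 1) * x 2)
  + (g 0 ^ 2 * h 1 * h 3 - g 0 * g 1 * h 0 * h 3 + g 0 * g 1 * h 1 * h 2
      + 4 * g 0 * g 2 * h 0 * h 2 - g 0 * g 2 * h 1 ^ 2 - g 0 * g 3 * h 0 * h 1
      - g 1 ^ 2 * h 0 * h 2 + g 1 * g 2 * h 0 * h 1 + g 1 * g 3 * h 0 ^ 2) * x 0 ^ 2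
  + 2 * (g 0 * g 1 * h 1 * h 3 + 2 * g 0 * g 2 * h 0 * h 3 + 2 * g 0 * g 3 * h 0 * h 2
      - g 0 * g 3 * h 1 ^ 2 - g 1 ^ 2 * h 0 * h 3 + g 1 * g 3 * h 0 * h 1) * x 0 * x 1
  + 2 * (-g 0 ^ 2 * h 3 ^ 2 + g 0 * g 1 * h 2 * h 3 + g 0 * g 2 * h 1 * h 3
      + 2 * g 0 * g 3 * h 0 * h 3 + g 1 * g 3 * h 0 * h 2 + g 2 * g 3 * h 0 * h 1
      - g 3 ^ 2 * h 0 ^ 2) * x 0 * x 2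
  + (g 0 * g 2 * h 1 * h 3 + 4 * g 0 * g 3 * h 0 * h 3 - g 0 * g 3 * h 1 * h 2
      - g 1 * g 2 * h 0 * h 3 + g 1 * g 3 * h 0 * h 2) * x 1 ^ 2
  + 2 * (g 0 * g 2 * h 2 * h 3 + 2 * g 0 * g 3 * h 1 * h 3 - g 0 * g 3 * h 2 ^ 2
      + 2 * g 1 * g 3 * h 0 * h 3 - g 2 ^ 2 * h 0 * h 3 + g 2 * g 3 * h 0 * h 2) * x 1 * x 2
  + (g 0 * g 2 * h 3 ^ 2 - g 0 * g 3 * h 2 * h 3 + g 1 * g 2 * h 2 * h 3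
      + 4 * g 1 * g 3 * h 1 * h 3 - g 1 * g 3 * h 2 ^ 2 - g 2 ^ 2 * h 1 * h 3
      - g 2 * g 3 * h 0 * h 3 + g 2 * g 3 * h 1 * h 2 + g 3 ^ 2 * h 0 * h 2) * x 2 ^ 2

/-- The quadratic form `y_{S,S'}` in the Kummer coordinates that belongs to `{S, Sᶜ}`. -/
def yForm (p q : Fin 6 → ℂ) (S : Finset (Fin 6)) (x : Fin 4 → ℂ) : ℂ :=
  quadForm (cubicCoeff p q S) (cubicCoeff p q Sᶜ) x

/-- The numerators of `4 a_{i,{S,S'}}`, as forms in the coefficients of the two cubics. -/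
def aNumerator (g h : ℕ → ℂ) : Fin 4 → ℂ :=
  ![g 2 * h 3 - g 3 * h 2,
    g 0 * h 3 + g 1 * h 2 - g 2 * h 1 - g 3 * h 0,
    g 0 * h 1 - g 1 * h 0,
    g 0^2*g 2*h 1*h 3^2 + 4*g 0^2*g 3*h 0*h 3^2 - g 0^2*g 3*h 1*h 2*h 3 - g 0*g 1*g 2*h 0*h 3^2
    + g 0*g 1*g 2*h 1*h 2*h 3 - 3*g 0*g 1*g 3*h 0*h 2*h 3 + 4*g 0*g 1*g 3*h 1^2*h 3 - g 0*g 1*g 3*h 1*h 2^2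
    + 4*g 0*g 2^2*h 0*h 2*h 3 - g 0*g 2^2*h 1^2*h 3 + 3*g 0*g 2*g 3*h 0*h 1*h 3 - 4*g 0*g 2*g 3*h 0*h 2^2
    + g 0*g 2*g 3*h 1^2*h 2 - 4*g 0*g 3^2*h 0^2*h 3 + g 0*g 3^2*h 0*h 1*h 2 - g 1^2*g 2*h 0*h 2*h 3
    - 4*g 1^2*g 3*h 0*h 1*h 3 + g 1^2*g 3*h 0*h 2^2 + g 1*g 2^2*h 0*h 1*h 3 + g 1*g 2*g 3*h 0^2*h 3
    - g 1*g 2*g 3*h 0*h 1*h 2 - g 1*g 3^2*h 0^2*h 2]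

/-- The coefficients `a_{i,{S,S'}}` in `xᵢ² = ∑ a_{i,{S,S'}} y_{S,S'}(x)`, the sum being over the
ten partitions. -/
def aCoeff (p q : Fin 6 → ℂ) (i : Fin 4) (S : Finset (Fin 6)) : ℂ :=
  aNumerator (cubicCoeff p q S) (cubicCoeff p q Sᶜ) i / (4 * resultant p q S)

/-- The coefficients `b_{{S,S'},j}` in `y_{S,S'}(x)² = ∑ⱼ b_{{S,S'},j} δⱼ(x)`, which holds for
Kummer coordinates `x`. -/
def bCoeff (p q : Fin 6 → ℂ) (S : Finset (Fin 6)) : Fin 4 → ℂ :=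
  let g := cubicCoeff p q S
  let h := cubicCoeff p q Sᶜ
  ![g 0 * h 2 + g 2 * h 0, g 0 * h 3 + g 3 * h 0, g 1 * h 3 + g 3 * h 1, 1]

/-- The map `φ`. -/
def phi (p q : Fin 6 → ℂ) (d : Fin 4 → ℝ) : Fin 4 → ℝ := fun i =>
  Real.sqrt (∑ S ∈ partitions, ‖aCoeff p q i S‖ * Real.sqrt (∑ j, ‖bCoeff p q S j‖ * d j))

/-- The sequence `b₀ = (1, 1, 1, 1)`, `b_{n+1} = φ(b_n)`. -/
def boundSeq (p q : Fin 6 → ℂ) : ℕ → Fin 4 → ℝ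
  | 0 => fun _ => 1
  | n + 1 => phi p q (boundSeq p q n)

end Genus2

end

noncomputable section

namespace Genus2

/-! Duplication on the Kummer surface factors through ten quadratic forms. The squares `x i ^ 2` are
linear in the ten values `y_S(x)` (`sq_eq_sum_aCoeff_mul_yForm`), and on the surface the squares of
these values are linear in `δ(x)` (`yForm_sq`, from the identity `quadForm_sq`). The triangle
inequality, applied twice, gives `|x_i| ≤ φ_i(|δ(x)|)` (`norm_le_phi_of_sq`).

The map `φ` is monotone and homogeneous of degree `1/4`. Iterating the inequality along the orbit of
`x` therefore gives `log ‖x‖ - 4⁻ᴺ log ‖δᴺ(x)‖ ≤ log ‖b_N‖` (`log_norm_sub_le`). The left side is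
the `N`-th partial sum of the series for `μ̃`, and the remaining tail is `4⁻ᴺ` times the series at
`δᴺ(x)`. As `ε̃` is bounded on the cone over the Kummer surface, the supremum `s` of the series
there is finite and satisfies `s ≤ log ‖b_N‖ + 4⁻ᴺ s`; solving for `s` gives the bound. The same two
properties of `φ` make it a contraction with factor `1/4` for the sup distance of logarithms, so
`b_n` converges to a positive limit.

Two algebraic facts carry this. The ten forms are a basis of the quadratic forms in four variables,
because they are pairwise apolar (`sum_dualCoeffs_eq_zero`). And `δ` maps the Kummer surface to
itself (`kummerQuartic_dup`); this is derived from the square relations alone, through the classical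
equation of the surface in terms of six tropes. -/

/-- The quartic form that defines the Kummer surface. -/
def kummerQuartic (f : Fin 7 → ℂ) (x : Fin 4 → ℂ) : ℂ :=
  (x 1 ^ 2 - 4 * x 0 * x 2) * x 3 ^ 2
    - 2 * (2 * f 0 * x 0 ^ 3 + f 1 * x 0 ^ 2 * x 1 + 2 * f 2 * x 0 ^ 2 * x 2
      + f 3 * x 0 * x 1 * x 2 + 2 * f 4 * x 0 * x 2 ^ 2 + f 5 * x 1 * x 2 ^ 2
      + 2 * f 6 * x 2 ^ 3) * x 3
    + kummerConst f (x 0) (x 1) (x 2)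

/-- The coefficients of the product of two binary cubic forms. -/
def cubicMul (g h : ℕ → ℂ) : Fin 7 → ℂ :=
  ![g 0 * h 0, g 0 * h 1 + g 1 * h 0, g 0 * h 2 + g 1 * h 1 + g 2 * h 0,
    g 0 * h 3 + g 1 * h 2 + g 2 * h 1 + g 3 * h 0, g 1 * h 3 + g 2 * h 2 + g 3 * h 1,
    g 2 * h 3 + g 3 * h 2, g 3 * h 3]

/-- The linear form whose values at `δ(x)` are the squares of the values of `quadForm g h`. -/
def tropeForm (g h : ℕ → ℂ) (d : Fin 4 → ℂ) : ℂ :=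
  (g 0 * h 2 + g 2 * h 0) * d 0 + (g 0 * h 3 + g 3 * h 0) * d 1
    + (g 1 * h 3 + g 3 * h 1) * d 2 + d 3

theorem quadForm_sq (g h : ℕ → ℂ) (x : Fin 4 → ℂ) :
    quadForm g h x ^ 2 = tropeForm g h (dup (cubicMul g h) x)
      - (4 * g 0 * g 1 * h 2 * h 3 + 2 * g 0 * g 2 * h 1 * h 3 + 8 * g 0 * g 3 * h 0 * h 3
        + 2 * g 0 * g 3 * h 1 * h 2 + 2 * g 1 * g 2 * h 0 * h 3 + 2 * g 1 * g 3 * h 0 * h 2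
        + 4 * g 2 * g 3 * h 0 * h 1) * kummerQuartic (cubicMul g h) x := by
  simp only [tropeForm, kummerQuartic, kummerConst, quadForm, dup, dup1, dup2, dup3, dup4,
    dupConst1, dupConst2, dupConst3, dupConst4, cubicMul, Matrix.cons_val]
  generalize g 0 = g0, g 1 = g1, g 2 = g2, g 3 = g3, h 0 = h0, h 1 = h1, h 2 = h2, h 3 = h3,
    x 0 = x0, x 1 = x1, x 2 = x2, x 3 = x3
  ring

/-! ### Translation and reversal of the coordinate on the projective line -/

/-- The coefficients of the cubic form `G(X + t Z, Z)`. -/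
def cubicShift (t : ℂ) (g : ℕ → ℂ) : ℕ → ℂ
  | 0 => g 0 + t * g 1 + t ^ 2 * g 2 + t ^ 3 * g 3
  | 1 => g 1 + 2 * t * g 2 + 3 * t ^ 2 * g 3
  | 2 => g 2 + 3 * t * g 3
  | 3 => g 3
  | _ => 0

/-- The coefficients of the sextic form `F(X + t Z, Z)`. -/
def sexticShift (t : ℂ) (f : Fin 7 → ℂ) : Fin 7 → ℂ :=
  ![f 0 + t * f 1 + t ^ 2 * f 2 + t ^ 3 * f 3 + t ^ 4 * f 4 + t ^ 5 * f 5 + t ^ 6 * f 6,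
    f 1 + 2 * t * f 2 + 3 * t ^ 2 * f 3 + 4 * t ^ 3 * f 4 + 5 * t ^ 4 * f 5 + 6 * t ^ 5 * f 6,
    f 2 + 3 * t * f 3 + 6 * t ^ 2 * f 4 + 10 * t ^ 3 * f 5 + 15 * t ^ 4 * f 6,
    f 3 + 4 * t * f 4 + 10 * t ^ 2 * f 5 + 20 * t ^ 3 * f 6,
    f 4 + 5 * t * f 5 + 15 * t ^ 2 * f 6, f 5 + 6 * t * f 6, f 6]

/-- The effect on Kummer coordinates of the substitution `X ↦ X + t Z` in the sextic form. -/
def coordShift (t : ℂ) (f : Fin 7 → ℂ) (x : Fin 4 → ℂ) : Fin 4 → ℂ :=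
  ![x 0, x 1 - 2 * t * x 0, x 2 - t * x 1 + t ^ 2 * x 0,
    x 3 - (t * f 3 + 2 * t ^ 2 * f 4 + 4 * t ^ 3 * f 5 + 8 * t ^ 4 * f 6) * x 0
      + (t ^ 2 * f 5 + 4 * t ^ 3 * f 6) * x 1 - (2 * t * f 5 + 6 * t ^ 2 * f 6) * x 2]

/-- The same linear map `coordShift` serves here and in `quadForm_shift`, so relations between `x`
and `d` can be transported without knowing that `δ` is equivariant. -/
theorem tropeForm_shift (t : ℂ) (g h : ℕ → ℂ) (d : Fin 4 → ℂ) :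
    tropeForm (cubicShift t g) (cubicShift t h) (coordShift t (cubicMul g h) d)
      = tropeForm g h d := by
  simp only [cubicMul, cubicShift, coordShift, tropeForm, Matrix.cons_val]
  ring

theorem quadForm_shift (t : ℂ) (g h : ℕ → ℂ) (x : Fin 4 → ℂ) :
    quadForm (cubicShift t g) (cubicShift t h) (coordShift t (cubicMul g h) x)
      = quadForm g h x := by
  simp only [cubicMul, cubicShift, coordShift, quadForm, Matrix.cons_val]
  generalize g 0 = g0, g 1 = g1, g 2 = g2, g 3 = g3, h 0 = h0, h 1 = h1, h 2 = h2, h 3 = h3,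
    x 0 = x0, x 1 = x1, x 2 = x2, x 3 = x3
  ring

theorem kummerQuartic_shift (t : ℂ) (f : Fin 7 → ℂ) (x : Fin 4 → ℂ) :
    kummerQuartic (sexticShift t f) (coordShift t f x) = kummerQuartic f x := by
  simp only [kummerQuartic, kummerConst, sexticShift, coordShift, Matrix.cons_val]
  generalize f 0 = f0, f 1 = f1, f 2 = f2, f 3 = f3, f 4 = f4, f 5 = f5, f 6 = f6,
    x 0 = x0, x 1 = x1, x 2 = x2, x 3 = x3
  ring

/-- The coefficients of the cubic form `G(Z, X)`. -/
def cubicReverse (g : ℕ → ℂ) : ℕ → ℂ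
  | 0 => g 3
  | 1 => g 2
  | 2 => g 1
  | 3 => g 0
  | _ => 0

theorem tropeForm_reverse (g h : ℕ → ℂ) (d : Fin 4 → ℂ) :
    tropeForm (cubicReverse g) (cubicReverse h) ![d 2, d 1, d 0, d 3] = tropeForm g h d := by
  simp only [cubicReverse, tropeForm, Matrix.cons_val]
  ring

theorem quadForm_reverse (g h : ℕ → ℂ) (x : Fin 4 → ℂ) :
    quadForm (cubicReverse g) (cubicReverse h) ![x 2, x 1, x 0, x 3] = quadForm g h x := by
  simp only [cubicReverse, quadForm, Matrix.cons_val]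
  ring

theorem kummerQuartic_reverse (f : Fin 7 → ℂ) (x : Fin 4 → ℂ) :
    kummerQuartic ![f 6, f 5, f 4, f 3, f 2, f 1, f 0] ![x 2, x 1, x 0, x 3]
      = kummerQuartic f x := by
  simp only [kummerQuartic, kummerConst, Matrix.cons_val]
  ring

theorem sextic_shift (t : ℂ) (f : Fin 7 → ℂ) (X Z : ℂ) :
    sextic (sexticShift t f) X Z = sextic f (X + t * Z) Z := by
  simp only [sextic, sexticShift, Fin.sum_univ_succ, Fin.sum_univ_zero, Fin.val_zero,
    Fin.val_succ, Matrix.cons_val_zero, Matrix.cons_val_succ, Fin.succ_zero_eq_one,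
    Fin.succ_one_eq_two, Fin.reduceSucc]
  ring

theorem sextic_reverse (f : Fin 7 → ℂ) (X Z : ℂ) :
    sextic ![f 6, f 5, f 4, f 3, f 2, f 1, f 0] X Z = sextic f Z X := by
  simp only [sextic, Fin.sum_univ_succ, Fin.sum_univ_zero, Fin.val_zero,
    Fin.val_succ, Matrix.cons_val_zero, Matrix.cons_val_succ, Fin.succ_zero_eq_one,
    Fin.succ_one_eq_two, Fin.reduceSucc]
  ring

/-! ### The Kummer quartic in terms of six tropes -/

/-- The coefficients of the product of three linear forms. -/
def cubicOf (p₁ q₁ p₂ q₂ p₃ q₃ : ℂ) : ℕ → ℂ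
  | 0 => q₁ * q₂ * q₃
  | 1 => p₁ * q₂ * q₃ + q₁ * p₂ * q₃ + q₁ * q₂ * p₃
  | 2 => q₁ * p₂ * p₃ + p₁ * q₂ * p₃ + p₁ * p₂ * q₃
  | 3 => p₁ * p₂ * p₃
  | _ => 0

/-- The product of the quadratic forms that belong to the splittings `Z L₁ L₂ · X L₃ L₄` and
`Z L₃ L₄ · X L₁ L₂` of a sextic form, up to scaling of `X` and `Z`. -/
def evenPair (u v p₁ q₁ p₂ q₂ p₃ q₃ p₄ q₄ : ℂ) (x : Fin 4 → ℂ) : ℂ :=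
  quadForm (cubicOf 0 u p₁ q₁ p₂ q₂) (cubicOf v 0 p₃ q₃ p₄ q₄) x
    * quadForm (cubicOf 0 u p₃ q₃ p₄ q₄) (cubicOf v 0 p₁ q₁ p₂ q₂) x

-- A three-term relation whose coefficients are those of the Plücker relation of the four linear
-- forms. It holds for all `x`, not only on the Kummer surface.
set_option maxHeartbeats 4000000 in
theorem evenPair_relation (u v p₁ q₁ p₂ q₂ p₃ q₃ p₄ q₄ : ℂ) (x : Fin 4 → ℂ) :
    (p₁ * q₂ - p₂ * q₁) * (p₃ * q₄ - p₄ * q₃) * evenPair u v p₁ q₁ p₂ q₂ p₃ q₃ p₄ q₄ x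
      - (p₁ * q₃ - p₃ * q₁) * (p₂ * q₄ - p₄ * q₂) * evenPair u v p₁ q₁ p₃ q₃ p₂ q₂ p₄ q₄ x
      + (p₁ * q₄ - p₄ * q₁) * (p₂ * q₃ - p₃ * q₂) * evenPair u v p₁ q₁ p₄ q₄ p₂ q₂ p₃ q₃ x
      = 0 := by
  simp only [evenPair, quadForm, cubicOf]
  generalize x 0 = x0, x 1 = x1, x 2 = x2, x 3 = x3
  ring

/-- The product of the linear forms that belong to the splittings `Z L₁ L₂ · X L₃ L₄` and
`Z L₃ L₄ · X L₁ L₂` of a sextic form, up to scaling of `X` and `Z`. -/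
def tropePair (u v p₁ q₁ p₂ q₂ p₃ q₃ p₄ q₄ : ℂ) (x : Fin 4 → ℂ) : ℂ :=
  tropeForm (cubicOf 0 u p₁ q₁ p₂ q₂) (cubicOf v 0 p₃ q₃ p₄ q₄) x
    * tropeForm (cubicOf 0 u p₃ q₃ p₄ q₄) (cubicOf v 0 p₁ q₁ p₂ q₂) x

/-- This encodes the irrational equation `√(T₁T₁') ± √(T₂T₂') ± √(T₃T₃') = 0` of a Kummer surface,
up to constants under the roots. The auxiliary `D` keeps the identities small enough to expand. -/
theorem kummerQuartic_eq_tropePair (u v p₁ q₁ p₂ q₂ p₃ q₃ p₄ q₄ : ℂ) (x : Fin 4 → ℂ) :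
    ∃ D : ℂ,
      tropePair u v p₁ q₁ p₂ q₂ p₃ q₃ p₄ q₄ x = tropePair u v p₁ q₁ p₃ q₃ p₂ q₂ p₄ q₄ x
        + (p₁ * q₄ - p₄ * q₁) * (p₂ * q₃ - p₃ * q₂) * D ∧
      tropePair u v p₁ q₁ p₄ q₄ p₂ q₂ p₃ q₃ x = tropePair u v p₁ q₁ p₃ q₃ p₂ q₂ p₄ q₄ x
        - (p₁ * q₂ - p₂ * q₁) * (p₃ * q₄ - p₄ * q₃)
          * (D - (p₁ * q₃ - p₃ * q₁) * (p₂ * q₄ - p₄ * q₂) * ((u * v) ^ 2 * x 0 * x 2)) ∧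
      (u * v) ^ 2 *
        kummerQuartic (cubicMul (cubicOf 0 u p₁ q₁ p₂ q₂) (cubicOf v 0 p₃ q₃ p₄ q₄)) x =
      (D - (p₁ * q₄ - p₄ * q₁) * (p₂ * q₃ - p₃ * q₂) * ((u * v) ^ 2 * x 0 * x 2)) ^ 2
        - 4 * tropePair u v p₁ q₁ p₃ q₃ p₂ q₂ p₄ q₄ x * ((u * v) ^ 2 * x 0 * x 2) := by
  -- The witness is the difference of the first two trope pairs, divided by its factor `(p₁q₄ -
  -- p₄q₁)(p₂q₃ - p₃q₂)`.
  refine ⟨u * v * x 1 * x 3 - (u * v) ^ 2 * (p₁ * p₂ * p₃ * p₄ * x 2 ^ 2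
    + (p₁ * p₄ * q₂ * q₃ + p₂ * p₃ * q₁ * q₄) * x 0 * x 2 + q₁ * q₂ * q₃ * q₄ * x 0 ^ 2),
    ?_, ?_, ?_⟩
  all_goals
    simp only [tropePair, tropeForm, cubicOf, kummerQuartic, kummerConst, cubicMul,
      Matrix.cons_val]
    ring

theorem kummerQuartic_eq_zero_of_pairs {u v p₁ q₁ p₂ q₂ p₃ q₃ p₄ q₄ : ℂ} {x d : Fin 4 → ℂ}
    (hu : u ≠ 0) (hv : v ≠ 0)
    (h12 : p₁ * q₂ - p₂ * q₁ ≠ 0) (h34 : p₃ * q₄ - p₄ * q₃ ≠ 0)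
    (h13 : p₁ * q₃ - p₃ * q₁ ≠ 0) (h24 : p₂ * q₄ - p₄ * q₂ ≠ 0)
    (h14 : p₁ * q₄ - p₄ * q₁ ≠ 0) (h23 : p₂ * q₃ - p₃ * q₂ ≠ 0)
    (e₁ : evenPair u v p₁ q₁ p₂ q₂ p₃ q₃ p₄ q₄ x ^ 2 = tropePair u v p₁ q₁ p₂ q₂ p₃ q₃ p₄ q₄ d)
    (e₂ : evenPair u v p₁ q₁ p₃ q₃ p₂ q₂ p₄ q₄ x ^ 2 = tropePair u v p₁ q₁ p₃ q₃ p₂ q₂ p₄ q₄ d)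
    (e₃ : evenPair u v p₁ q₁ p₄ q₄ p₂ q₂ p₃ q₃ x ^ 2
      = tropePair u v p₁ q₁ p₄ q₄ p₂ q₂ p₃ q₃ d) :
    kummerQuartic (cubicMul (cubicOf 0 u p₁ q₁ p₂ q₂) (cubicOf v 0 p₃ q₃ p₄ q₄)) d = 0 := by
  obtain ⟨D, h₁, h₃, hK⟩ := kummerQuartic_eq_tropePair u v p₁ q₁ p₂ q₂ p₃ q₃ p₄ q₄ d
  have hr := evenPair_relation u v p₁ q₁ p₂ q₂ p₃ q₃ p₄ q₄ x
  -- The Plücker relation, to be used as `β = α + γ`.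
  have hsum : (p₁ * q₃ - p₃ * q₁) * (p₂ * q₄ - p₄ * q₂) =
    (p₁ * q₂ - p₂ * q₁) * (p₃ * q₄ - p₄ * q₃) + (p₁ * q₄ - p₄ * q₁) * (p₂ * q₃ - p₃ * q₂) := by
    ring
  have hα := mul_ne_zero h12 h34
  have hβ := mul_ne_zero h13 h24
  have hγ := mul_ne_zero h14 h23
  have hw := mul_ne_zero hu hv
  clear h12 h34 h13 h24 h14 h23 hu hv
  generalize (p₁ * q₂ - p₂ * q₁) * (p₃ * q₄ - p₄ * q₃) = α at *
  generalize (p₁ * q₃ - p₃ * q₁) * (p₂ * q₄ - p₄ * q₂) = β at *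
  generalize (p₁ * q₄ - p₄ * q₁) * (p₂ * q₃ - p₃ * q₂) = γ at *
  generalize kummerQuartic _ d = K at *
  generalize evenPair u v p₁ q₁ p₂ q₂ p₃ q₃ p₄ q₄ x = y₁ at *
  generalize evenPair u v p₁ q₁ p₃ q₃ p₂ q₂ p₄ q₄ x = y₂ at *
  generalize evenPair u v p₁ q₁ p₄ q₄ p₂ q₂ p₃ q₃ x = y₃ at *
  rw [← e₁, ← e₂] at h₁
  rw [← e₂, ← e₃] at h₃
  rw [← e₂] at hK
  generalize (u * v) ^ 2 * d 0 * d 2 = E at *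
  -- The left side is the Heron form `A² + B² + C² - 2AB - 2AC - 2BC` in `A = α²y₁²`, `B = β²y₂²`,
  -- `C = γ²y₃²`. That form is the product of the factors `αy₁ ± βy₂ ± γy₃`, one of which vanishes
  -- by `hr`.
  have key : (α * β * γ) ^ 2 * ((u * v) ^ 2 * K) = 0 := by
    have h4 : (α ^ 2 * y₁ ^ 2) ^ 2 + (β ^ 2 * y₂ ^ 2) ^ 2 + (γ ^ 2 * y₃ ^ 2) ^ 2
        - 2 * (α ^ 2 * y₁ ^ 2) * (β ^ 2 * y₂ ^ 2) - 2 * (α ^ 2 * y₁ ^ 2) * (γ ^ 2 * y₃ ^ 2)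
        - 2 * (β ^ 2 * y₂ ^ 2) * (γ ^ 2 * y₃ ^ 2) = 0 := by
      linear_combination (α * y₁ + β * y₂ + γ * y₃) * (α * y₁ - β * y₂ - γ * y₃)
        * (α * y₁ + β * y₂ - γ * y₃) * hr
    rw [hK, ← h4, h₁, h₃, hsum]
    ring
  have : (α * β * γ) ^ 2 ≠ 0 := pow_ne_zero _ (mul_ne_zero (mul_ne_zero hα hβ) hγ)
  have h2 : (u * v) ^ 2 ≠ 0 := pow_ne_zero _ hw
  simpa [this, h2] using key

/-! ### Apolarity of the ten quadratic forms -/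

/-- The coefficients of `quadForm g h` at the ten monomials of degree two. -/
def quadCoeffs (g h : ℕ → ℂ) : Fin 10 → ℂ :=
  ![g 0 ^ 2 * h 1 * h 3 - g 0 * g 1 * h 0 * h 3 + g 0 * g 1 * h 1 * h 2
      + 4 * g 0 * g 2 * h 0 * h 2 - g 0 * g 2 * h 1 ^ 2 - g 0 * g 3 * h 0 * h 1
      - g 1 ^ 2 * h 0 * h 2 + g 1 * g 2 * h 0 * h 1 + g 1 * g 3 * h 0 ^ 2,
    g 0 * g 2 * h 1 * h 3 + 4 * g 0 * g 3 * h 0 * h 3 - g 0 * g 3 * h 1 * h 2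
      - g 1 * g 2 * h 0 * h 3 + g 1 * g 3 * h 0 * h 2,
    g 0 * g 2 * h 3 ^ 2 - g 0 * g 3 * h 2 * h 3 + g 1 * g 2 * h 2 * h 3
      + 4 * g 1 * g 3 * h 1 * h 3 - g 1 * g 3 * h 2 ^ 2 - g 2 ^ 2 * h 1 * h 3
      - g 2 * g 3 * h 0 * h 3 + g 2 * g 3 * h 1 * h 2 + g 3 ^ 2 * h 0 * h 2,
    1,
    2 * (g 0 * g 1 * h 1 * h 3 + 2 * g 0 * g 2 * h 0 * h 3 + 2 * g 0 * g 3 * h 0 * h 2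
      - g 0 * g 3 * h 1 ^ 2 - g 1 ^ 2 * h 0 * h 3 + g 1 * g 3 * h 0 * h 1),
    2 * (-g 0 ^ 2 * h 3 ^ 2 + g 0 * g 1 * h 2 * h 3 + g 0 * g 2 * h 1 * h 3
      + 2 * g 0 * g 3 * h 0 * h 3 + g 1 * g 3 * h 0 * h 2 + g 2 * g 3 * h 0 * h 1
      - g 3 ^ 2 * h 0 ^ 2),
    2 * (g 0 * h 2 + g 2 * h 0),
    2 * (g 0 * g 2 * h 2 * h 3 + 2 * g 0 * g 3 * h 1 * h 3 - g 0 * g 3 * h 2 ^ 2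
      + 2 * g 1 * g 3 * h 0 * h 3 - g 2 ^ 2 * h 0 * h 3 + g 2 * g 3 * h 0 * h 2),
    2 * (g 0 * h 3 + g 3 * h 0),
    2 * (g 1 * h 3 + g 3 * h 1)]

/-- The coefficients of a quadratic form dual to `quadForm g h`; its Gram matrix is the resultant
times the inverse of the Gram matrix of `quadForm g h`. -/
def dualCoeffs (g h : ℕ → ℂ) : Fin 10 → ℂ :=
  ![aNumerator g h 0, aNumerator g h 1, aNumerator g h 2, aNumerator g h 3,
    -g 1 * h 3 + g 3 * h 1,
    g 0 * h 3 - g 3 * h 0,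
    -g 0 * g 2 * h 2 * h 3 - 2 * g 0 * g 3 * h 1 * h 3 + g 0 * g 3 * h 2 ^ 2
      + 2 * g 1 * g 3 * h 0 * h 3 + g 2 * g 3 * h 0 * h 2 - g 2 ^ 2 * h 0 * h 3,
    -g 0 * h 2 + g 2 * h 0,
    g 0 * g 1 * h 2 * h 3 + g 0 * g 2 * h 1 * h 3 - g 0 ^ 2 * h 3 ^ 2 - g 1 * g 3 * h 0 * h 2
      - g 2 * g 3 * h 0 * h 1 + g 3 ^ 2 * h 0 ^ 2,
    -g 0 * g 1 * h 1 * h 3 - 2 * g 0 * g 2 * h 0 * h 3 + 2 * g 0 * g 3 * h 0 * h 2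
      - g 0 * g 3 * h 1 ^ 2 + g 1 * g 3 * h 0 * h 1 + g 1 ^ 2 * h 0 * h 3]

/-- The monomials of degree two. -/
def quadMonomials (x : Fin 4 → ℂ) : Fin 10 → ℂ :=
  ![x 0 ^ 2, x 1 ^ 2, x 2 ^ 2, x 3 ^ 2, x 0 * x 1, x 0 * x 2, x 0 * x 3, x 1 * x 2, x 1 * x 3,
    x 2 * x 3]

theorem quadForm_eq_sum (g h : ℕ → ℂ) (x : Fin 4 → ℂ) :
    quadForm g h x = ∑ k, quadCoeffs g h k * quadMonomials x k := by
  simp only [Fin.sum_univ_succ, Fin.sum_univ_zero, Fin.succ_zero_eq_one,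
    Fin.succ_one_eq_two, Fin.reduceSucc, quadCoeffs, quadMonomials, quadForm,
    Matrix.cons_val]
  ring

/-- The coefficients of the product of the linear form `p X + q Z` and a quadratic form. -/
def linearMul (p q : ℂ) (a : ℕ → ℂ) : ℕ → ℂ
  | 0 => q * a 0
  | 1 => q * a 1 + p * a 0
  | 2 => q * a 2 + p * a 1
  | 3 => p * a 2
  | _ => 0

/-- Off the diagonal only `quadCoeffs` carries the factor `2`, so the sum is the trace of a product
of Gram matrices. Its vanishing is apolarity of two forms whose factorizations differ by exchanging
one root between the cubics. -/
theorem sum_dualCoeffs_mul_quadCoeffs_exchange (p₁ q₁ p₂ q₂ : ℂ) (a b : ℕ → ℂ) :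
    ∑ k, quadCoeffs (linearMul p₁ q₁ a) (linearMul p₂ q₂ b) k
      * dualCoeffs (linearMul p₂ q₂ a) (linearMul p₁ q₁ b) k = 0 := by
  simp only [Fin.sum_univ_succ, Fin.sum_univ_zero, Fin.succ_zero_eq_one,
    Fin.succ_one_eq_two, Fin.reduceSucc, quadCoeffs, dualCoeffs, aNumerator, linearMul,
    Matrix.cons_val]
  generalize a 0 = a0, a 1 = a1, a 2 = a2, b 0 = b0, b 1 = b1, b 2 = b2
  ring

/-- The two Gram matrices multiply to the resultant times the `4 × 4` identity; the factor `4` is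
the trace of the latter. -/
theorem sum_dualCoeffs_mul_quadCoeffs (p₁ q₁ p₂ q₂ p₃ q₃ p₄ q₄ p₅ q₅ p₆ q₆ : ℂ) :
    ∑ k, quadCoeffs (cubicOf p₁ q₁ p₂ q₂ p₃ q₃) (cubicOf p₄ q₄ p₅ q₅ p₆ q₆) k
      * dualCoeffs (cubicOf p₁ q₁ p₂ q₂ p₃ q₃) (cubicOf p₄ q₄ p₅ q₅ p₆ q₆) k
    = 4 * (((p₁ * q₄ - p₄ * q₁) * (p₁ * q₅ - p₅ * q₁) * (p₁ * q₆ - p₆ * q₁)) *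
      ((p₂ * q₄ - p₄ * q₂) * (p₂ * q₅ - p₅ * q₂) * (p₂ * q₆ - p₆ * q₂)) *
      ((p₃ * q₄ - p₄ * q₃) * (p₃ * q₅ - p₅ * q₃) * (p₃ * q₆ - p₆ * q₃))) := by
  simp only [Fin.sum_univ_succ, Fin.sum_univ_zero, Fin.succ_zero_eq_one,
    Fin.succ_one_eq_two, Fin.reduceSucc, quadCoeffs, dualCoeffs, aNumerator, cubicOf,
    Matrix.cons_val]
  ring

/-! ### The coefficients of products of linear forms -/

theorem cubicCoeff_empty (p q : Fin 6 → ℂ) (k : ℕ) :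
    cubicCoeff p q ∅ k = if k = 0 then 1 else 0 := by
  simp [cubicCoeff, Polynomial.coeff_one]

theorem cubicCoeff_insert_zero (p q : Fin 6 → ℂ) {i : Fin 6} {A : Finset (Fin 6)} (h : i ∉ A) :
    cubicCoeff p q (insert i A) 0 = q i * cubicCoeff p q A 0 := by
  simp [cubicCoeff, Finset.prod_insert h, Polynomial.mul_coeff_zero]

theorem cubicCoeff_insert_succ (p q : Fin 6 → ℂ) {i : Fin 6} {A : Finset (Fin 6)} (h : i ∉ A)
    (k : ℕ) :
    cubicCoeff p q (insert i A) (k + 1) = q i * cubicCoeff p q A (k + 1)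
      + p i * cubicCoeff p q A k := by
  simp [cubicCoeff, Finset.prod_insert h, add_mul, mul_assoc, Polynomial.coeff_X_mul, add_comm]

theorem cubicCoeff_singleton_zero (p q : Fin 6 → ℂ) (i : Fin 6) :
    cubicCoeff p q {i} 0 = q i := by
  rw [← insert_empty_eq, cubicCoeff_insert_zero p q (Finset.notMem_empty i), cubicCoeff_empty]
  simp

theorem cubicCoeff_singleton_succ (p q : Fin 6 → ℂ) (i : Fin 6) (k : ℕ) :
    cubicCoeff p q {i} (k + 1) = if k = 0 then p i else 0 := by
  rw [← insert_empty_eq, cubicCoeff_insert_succ p q (Finset.notMem_empty i), cubicCoeff_empty,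
    cubicCoeff_empty]
  simp

theorem cubicCoeff_insert_of_card_eq_two (p q : Fin 6 → ℂ) {i : Fin 6} {A : Finset (Fin 6)}
    (h : i ∉ A) (hA : A.card = 2) :
    cubicCoeff p q (insert i A) = linearMul (p i) (q i) (cubicCoeff p q A) := by
  obtain ⟨a, b, hab, rfl⟩ := Finset.card_eq_two.1 hA
  have hb : a ∉ ({b} : Finset (Fin 6)) := by simpa using hab
  have hv : ∀ k, cubicCoeff p q {a, b} (k + 3) = 0 := fun k => by
    rw [cubicCoeff_insert_succ p q hb, cubicCoeff_singleton_succ, cubicCoeff_singleton_succ]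
    simp
  funext k
  match k with
  | 0 => rw [cubicCoeff_insert_zero p q h]; rfl
  | 1 => rw [cubicCoeff_insert_succ p q h]; rfl
  | 2 => rw [cubicCoeff_insert_succ p q h]; rfl
  | 3 => rw [cubicCoeff_insert_succ p q h, hv]; simp [linearMul]
  | k + 4 =>
    rw [cubicCoeff_insert_succ p q h, show k + 3 + 1 = k + 1 + 3 from rfl, hv, hv]
    simp [linearMul]

theorem cubicCoeff_triple (p q : Fin 6 → ℂ) {a b c : Fin 6} (hab : a ≠ b) (hac : a ≠ c)
    (hbc : b ≠ c) :
    cubicCoeff p q {a, b, c} = cubicOf (p a) (q a) (p b) (q b) (p c) (q c) := by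
  have hc : b ∉ ({c} : Finset (Fin 6)) := by simpa using hbc
  have ha : a ∉ ({b, c} : Finset (Fin 6)) := by simp [hab, hac]
  rw [cubicCoeff_insert_of_card_eq_two p q ha (Finset.card_pair hbc)]
  have h0 : cubicCoeff p q {b, c} 0 = q b * q c := by
    rw [cubicCoeff_insert_zero p q hc, cubicCoeff_singleton_zero]
  have h1 : cubicCoeff p q {b, c} 1 = q b * p c + p b * q c := by
    rw [cubicCoeff_insert_succ p q hc, cubicCoeff_singleton_succ, cubicCoeff_singleton_zero]
    simp
  have h2 : cubicCoeff p q {b, c} 2 = p b * p c := by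
    rw [cubicCoeff_insert_succ p q hc, cubicCoeff_singleton_succ, cubicCoeff_singleton_succ]
    simp
  funext k
  match k with
  | 0 | 1 | 2 | 3 => simp only [linearMul, cubicOf, h0, h1, h2]; try ring
  | k + 4 => rfl

theorem cubicCoeff_shift (p q : Fin 6 → ℂ) (t : ℂ) {S : Finset (Fin 6)} (hS : S.card = 3) :
    cubicCoeff p (fun i => q i + t * p i) S = cubicShift t (cubicCoeff p q S) := by
  obtain ⟨a, b, c, hab, hac, hbc, rfl⟩ := Finset.card_eq_three.1 hS
  rw [cubicCoeff_triple _ _ hab hac hbc, cubicCoeff_triple _ _ hab hac hbc]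
  funext k
  match k with
  | 0 | 1 | 2 | 3 => simp only [cubicOf, cubicShift]; try ring
  | k + 4 => rfl

theorem cubicCoeff_reverse (p q : Fin 6 → ℂ) {S : Finset (Fin 6)} (hS : S.card = 3) :
    cubicCoeff q p S = cubicReverse (cubicCoeff p q S) := by
  obtain ⟨a, b, c, hab, hac, hbc, rfl⟩ := Finset.card_eq_three.1 hS
  rw [cubicCoeff_triple _ _ hab hac hbc, cubicCoeff_triple _ _ hab hac hbc]
  funext k
  match k with
  | 0 | 1 | 2 | 3 => simp only [cubicOf, cubicReverse]; try ring
  | k + 4 => rfl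

theorem mem_partitions {S : Finset (Fin 6)} : S ∈ partitions ↔ S.card = 3 ∧ (0 : Fin 6) ∈ S := by
  simp [partitions]

theorem card_compl_of_mem_partitions {S : Finset (Fin 6)} (hS : S ∈ partitions) :
    Sᶜ.card = 3 := by
  rw [Finset.card_compl, (mem_partitions.1 hS).1]; rfl

theorem card_partitions : partitions.card = 10 := by decide

/-! ### The factorization of the sextic form -/

theorem eq_zero_of_forall_sum_mul_pow {n : ℕ} {c : Fin n → ℂ}
    (h : ∀ X : ℂ, ∑ i, c i * X ^ (i : ℕ) = 0) : c = 0 := by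
  have hP : (∑ i, Polynomial.C (c i) * Polynomial.X ^ (i : ℕ) : Polynomial ℂ) = 0 :=
    Polynomial.funext fun X => by simpa [Polynomial.eval_finsetSum] using h X
  funext k
  have := congrArg (fun P => P.coeff (k : ℕ)) hP
  simpa [Polynomial.finsetSum_coeff, Polynomial.coeff_C_mul, Polynomial.coeff_X_pow,
    Fin.val_inj] using this

theorem eq_cubicMul {f : Fin 7 → ℂ} {p q : Fin 6 → ℂ}
    (hF : ∀ X Z : ℂ, sextic f X Z = ∏ i, (p i * X + q i * Z)) {S : Finset (Fin 6)}
    (hS : S ∈ partitions) : f = cubicMul (cubicCoeff p q S) (cubicCoeff p q Sᶜ) := by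
  have h1 := (mem_partitions.1 hS).1
  have h2 := card_compl_of_mem_partitions hS
  have key : ∀ {T : Finset (Fin 6)}, T.card = 3 → ∀ X : ℂ, ∏ i ∈ T, (p i * X + q i * 1) =
      cubicCoeff p q T 0 + cubicCoeff p q T 1 * X + cubicCoeff p q T 2 * X ^ 2
        + cubicCoeff p q T 3 * X ^ 3 := by
    intro T hT X
    obtain ⟨a, b, c, hab, hac, hbc, rfl⟩ := Finset.card_eq_three.1 hT
    rw [cubicCoeff_triple _ _ hab hac hbc, Finset.prod_insert (by simp [hab, hac]),
      Finset.prod_pair hbc]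
    simp only [cubicOf]
    ring
  refine sub_eq_zero.1 (eq_zero_of_forall_sum_mul_pow fun X => ?_)
  have hX := hF X 1
  rw [← Finset.prod_mul_prod_compl S, key h1, key h2] at hX
  simp only [sextic, one_pow, mul_one] at hX
  simp only [Pi.sub_apply, sub_mul, Finset.sum_sub_distrib, hX]
  simp only [cubicMul, Fin.sum_univ_succ, Fin.sum_univ_zero, Matrix.cons_val_zero,
    Matrix.cons_val_succ, Fin.val_zero, Fin.val_succ]
  ring

/-! ### The duplication map preserves the Kummer surface -/

theorem yForm_eq (p q : Fin 6 → ℂ) (S : Finset (Fin 6)) (x : Fin 4 → ℂ) :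
    yForm p q S x = quadForm (cubicCoeff p q S) (cubicCoeff p q Sᶜ) x := rfl

theorem sum_bCoeff_mul (p q : Fin 6 → ℂ) (S : Finset (Fin 6)) (d : Fin 4 → ℂ) :
    ∑ j, bCoeff p q S j * d j = tropeForm (cubicCoeff p q S) (cubicCoeff p q Sᶜ) d := by
  simp [Fin.sum_univ_four, bCoeff, tropeForm]

theorem yForm_sq {f : Fin 7 → ℂ} {p q : Fin 6 → ℂ}
    (hF : ∀ X Z : ℂ, sextic f X Z = ∏ i, (p i * X + q i * Z)) {x : Fin 4 → ℂ}
    (hx : kummerQuartic f x = 0) {S : Finset (Fin 6)} (hS : S ∈ partitions) :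
    yForm p q S x ^ 2 = ∑ j, bCoeff p q S j * dup f x j := by
  rw [sum_bCoeff_mul, yForm_eq, quadForm_sq, ← eq_cubicMul hF hS, hx, mul_zero, sub_zero]

/-- The ten relations between the squares of the forms `y_{S,S'}` at `x` and the linear forms with
coefficients `b_{S,S'}` at `d`. -/
def SquareRelations (p q : Fin 6 → ℂ) (x d : Fin 4 → ℂ) : Prop :=
  ∀ S ∈ partitions, quadForm (cubicCoeff p q S) (cubicCoeff p q Sᶜ) x ^ 2
    = tropeForm (cubicCoeff p q S) (cubicCoeff p q Sᶜ) d

theorem kummerQuartic_eq_zero_of_normalized {f : Fin 7 → ℂ} {p q : Fin 6 → ℂ}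
    (hF : ∀ X Z : ℂ, sextic f X Z = ∏ i, (p i * X + q i * Z))
    (hdisc : ∀ i j, i ≠ j → p i * q j - p j * q i ≠ 0) (hp : p 0 = 0) (hq : q 1 = 0)
    {x d : Fin 4 → ℂ} (h : SquareRelations p q x d) : kummerQuartic f d = 0 := by
  rw [eq_cubicMul hF (S := {0, 2, 3}) (by decide)]
  have c23 : ({0, 2, 3} : Finset (Fin 6))ᶜ = {1, 4, 5} := by decide
  have c45 : ({0, 4, 5} : Finset (Fin 6))ᶜ = {1, 2, 3} := by decide
  have c24 : ({0, 2, 4} : Finset (Fin 6))ᶜ = {1, 3, 5} := by decide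
  have c35 : ({0, 3, 5} : Finset (Fin 6))ᶜ = {1, 2, 4} := by decide
  have c25 : ({0, 2, 5} : Finset (Fin 6))ᶜ = {1, 3, 4} := by decide
  have c34 : ({0, 3, 4} : Finset (Fin 6))ᶜ = {1, 2, 5} := by decide
  have e23 := h {0, 2, 3} (by decide)
  have e45 := h {0, 4, 5} (by decide)
  have e24 := h {0, 2, 4} (by decide)
  have e35 := h {0, 3, 5} (by decide)
  have e25 := h {0, 2, 5} (by decide)
  have e34 := h {0, 3, 4} (by decide)
  have t := @cubicCoeff_triple p q
  rw [c23, t (by decide) (by decide) (by decide), t (by decide) (by decide) (by decide), hp, hq]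
    at e23 ⊢
  rw [c45, t (by decide) (by decide) (by decide), t (by decide) (by decide) (by decide), hp, hq]
    at e45
  rw [c24, t (by decide) (by decide) (by decide), t (by decide) (by decide) (by decide), hp, hq]
    at e24
  rw [c35, t (by decide) (by decide) (by decide), t (by decide) (by decide) (by decide), hp, hq]
    at e35
  rw [c25, t (by decide) (by decide) (by decide), t (by decide) (by decide) (by decide), hp, hq]
    at e25
  rw [c34, t (by decide) (by decide) (by decide), t (by decide) (by decide) (by decide), hp, hq]
    at e34
  have h01 := hdisc 0 1 (by decide)
  have hu : q 0 ≠ 0 := fun hz => h01 (by rw [hp, hz]; ring)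
  have hv : p 1 ≠ 0 := fun hz => h01 (by rw [hp, hz]; ring)
  refine kummerQuartic_eq_zero_of_pairs (x := x) hu hv (hdisc 2 3 (by decide))
    (hdisc 4 5 (by decide)) (hdisc 2 4 (by decide)) (hdisc 3 5 (by decide))
    (hdisc 2 5 (by decide)) (hdisc 3 4 (by decide)) ?_ ?_ ?_
  · rw [evenPair, tropePair, mul_pow, e23, e45]
  · rw [evenPair, tropePair, mul_pow, e24, e35]
  · rw [evenPair, tropePair, mul_pow, e25, e34]

theorem SquareRelations.shift {f : Fin 7 → ℂ} {p q : Fin 6 → ℂ}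
    (hF : ∀ X Z : ℂ, sextic f X Z = ∏ i, (p i * X + q i * Z)) (t : ℂ) {x d : Fin 4 → ℂ}
    (h : SquareRelations p q x d) :
    SquareRelations p (fun i => q i + t * p i) (coordShift t f x) (coordShift t f d) :=
  fun S hS => by
    rw [cubicCoeff_shift _ _ _ (mem_partitions.1 hS).1,
      cubicCoeff_shift _ _ _ (card_compl_of_mem_partitions hS), eq_cubicMul hF hS, quadForm_shift,
      tropeForm_shift, h S hS]

theorem SquareRelations.reverse {p q : Fin 6 → ℂ} {x d : Fin 4 → ℂ}
    (h : SquareRelations p q x d) :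
    SquareRelations q p ![x 2, x 1, x 0, x 3] ![d 2, d 1, d 0, d 3] := fun S hS => by
  rw [cubicCoeff_reverse _ _ (mem_partitions.1 hS).1,
    cubicCoeff_reverse _ _ (card_compl_of_mem_partitions hS), quadForm_reverse,
    tropeForm_reverse, h S hS]

theorem sextic_shift_eq_prod {f : Fin 7 → ℂ} {p q : Fin 6 → ℂ}
    (hF : ∀ X Z : ℂ, sextic f X Z = ∏ i, (p i * X + q i * Z)) (t X Z : ℂ) :
    sextic (sexticShift t f) X Z = ∏ i, (p i * X + (q i + t * p i) * Z) := by
  rw [sextic_shift, hF]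
  exact Finset.prod_congr rfl fun i _ => by ring

theorem kummerQuartic_eq_zero_of_left_eq_zero {f : Fin 7 → ℂ} {p q : Fin 6 → ℂ}
    (hF : ∀ X Z : ℂ, sextic f X Z = ∏ i, (p i * X + q i * Z))
    (hdisc : ∀ i j, i ≠ j → p i * q j - p j * q i ≠ 0) (hp : p 0 = 0)
    {x d : Fin 4 → ℂ} (h : SquareRelations p q x d) : kummerQuartic f d = 0 := by
  have hp1 : p 1 ≠ 0 := fun hz => hdisc 0 1 (by decide) (by rw [hp, hz]; ring)
  -- The shift makes the linear form with index `1` a multiple of `X`; it does not change `p`, so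
  -- the one with index `0` remains a multiple of `Z`.
  rw [← kummerQuartic_shift (-(q 1 / p 1)) f d]
  refine kummerQuartic_eq_zero_of_normalized (sextic_shift_eq_prod hF _) (fun i j hij hz => ?_) hp
    (by field_simp; ring) (h.shift hF _)
  exact hdisc i j hij (by linear_combination hz)

theorem kummerQuartic_eq_zero {f : Fin 7 → ℂ} {p q : Fin 6 → ℂ}
    (hF : ∀ X Z : ℂ, sextic f X Z = ∏ i, (p i * X + q i * Z))
    (hdisc : ∀ i j, i ≠ j → p i * q j - p j * q i ≠ 0)
    {x d : Fin 4 → ℂ} (h : SquareRelations p q x d) : kummerQuartic f d = 0 := by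
  by_cases hp : p 0 = 0
  · exact kummerQuartic_eq_zero_of_left_eq_zero hF hdisc hp h
  -- The shift makes the linear form with index `0` a multiple of `X`, and exchanging `X` and `Z`
  -- turns it into a multiple of `Z`.
  rw [← kummerQuartic_shift (-(q 0 / p 0)) f d, ← kummerQuartic_reverse]
  refine kummerQuartic_eq_zero_of_left_eq_zero (p := fun i => q i + -(q 0 / p 0) * p i) (q := p)
    (fun X Z => ?_) (fun i j hij hz => ?_) (by field_simp; ring) (h.shift hF _).reverse
  · rw [sextic_reverse, sextic_shift_eq_prod hF]
    exact Finset.prod_congr rfl fun i _ => by ring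
  · exact hdisc i j hij (by linear_combination -hz)

/-- The square relations between `x` and `δ(x)` already force `δ(x)` onto the surface, which avoids
expanding a form of degree `16`. -/
theorem kummerQuartic_dup {f : Fin 7 → ℂ} {p q : Fin 6 → ℂ}
    (hF : ∀ X Z : ℂ, sextic f X Z = ∏ i, (p i * X + q i * Z))
    (hdisc : ∀ i j, i ≠ j → p i * q j - p j * q i ≠ 0)
    {x : Fin 4 → ℂ} (hx : kummerQuartic f x = 0) : kummerQuartic f (dup f x) = 0 :=
  kummerQuartic_eq_zero hF hdisc fun S hS => by
    rw [← yForm_eq, ← sum_bCoeff_mul, yForm_sq hF hx hS]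

/-! ### The squares of the coordinates as combinations of the ten quadratic forms -/

theorem sum_dualCoeffs_mul_quadCoeffs_self (p q : Fin 6 → ℂ) {S : Finset (Fin 6)} (hS : S ∈ partitions) :
    ∑ k, quadCoeffs (cubicCoeff p q S) (cubicCoeff p q Sᶜ) k
      * dualCoeffs (cubicCoeff p q S) (cubicCoeff p q Sᶜ) k = 4 * resultant p q S := by
  obtain ⟨a, b, c, hab, hac, hbc, h1⟩ := Finset.card_eq_three.1 (mem_partitions.1 hS).1
  obtain ⟨a', b', c', hab', hac', hbc', h2⟩ :=
    Finset.card_eq_three.1 (card_compl_of_mem_partitions hS)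
  rw [resultant, h2, h1, cubicCoeff_triple _ _ hab hac hbc, cubicCoeff_triple _ _ hab' hac' hbc',
    sum_dualCoeffs_mul_quadCoeffs]
  have e : ∀ {a b c : Fin 6}, a ≠ b → a ≠ c → b ≠ c → ∀ F : Fin 6 → ℂ,
      ∏ i ∈ ({a, b, c} : Finset (Fin 6)), F i = F a * F b * F c := fun h h' h'' F => by
    rw [Finset.prod_insert (by simp [h, h']), Finset.prod_pair h'', mul_assoc]
  simp only [e hab hac hbc, e hab' hac' hbc']

theorem quadCoeffs_symm (g h : ℕ → ℂ) : quadCoeffs g h = quadCoeffs h g := by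
  funext k
  fin_cases k <;> simp [quadCoeffs] <;> ring

theorem sum_dualCoeffs_eq_zero_of_card_inter (p q : Fin 6 → ℂ) {S T : Finset (Fin 6)}
    (hS : S.card = 3) (hT : T.card = 3) (h : (S ∩ T).card = 2) :
    ∑ k, quadCoeffs (cubicCoeff p q T) (cubicCoeff p q Tᶜ) k
      * dualCoeffs (cubicCoeff p q S) (cubicCoeff p q Sᶜ) k = 0 := by
  have h1 : (S \ T).card = 1 := by
    have := Finset.card_inter_add_card_sdiff S T; omega
  have h2 : (T \ S).card = 1 := by
    have := Finset.card_inter_add_card_sdiff T S; rw [Finset.inter_comm] at this; omega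
  obtain ⟨i, hi⟩ := Finset.card_eq_one.1 h1
  obtain ⟨j, hj⟩ := Finset.card_eq_one.1 h2
  have hi' : i ∈ S ∧ i ∉ T := by
    rw [← Finset.mem_sdiff, hi]; exact Finset.mem_singleton_self i
  have hj' : j ∈ T ∧ j ∉ S := by
    rw [← Finset.mem_sdiff, hj]; exact Finset.mem_singleton_self j
  have h3 : (S ∪ T)ᶜ.card = 2 := by
    have := Finset.card_union_add_card_inter S T
    rw [Finset.card_compl, Fintype.card_fin]; omega
  have hSe : ∀ k, k ∈ S ∧ k ∉ T ↔ k = i := fun k => by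
    rw [← Finset.mem_sdiff, hi, Finset.mem_singleton]
  have hTe : ∀ k, k ∈ T ∧ k ∉ S ↔ k = j := fun k => by
    rw [← Finset.mem_sdiff, hj, Finset.mem_singleton]
  have eS : S = insert i (S ∩ T) := by
    ext k; have := hSe k; simp only [Finset.mem_insert, Finset.mem_inter]; tauto
  have eT : T = insert j (S ∩ T) := by
    ext k; have := hTe k; simp only [Finset.mem_insert, Finset.mem_inter]; tauto
  have eS' : Sᶜ = insert j (S ∪ T)ᶜ := by
    ext k; have := hTe k
    simp only [Finset.mem_insert, Finset.mem_compl, Finset.mem_union]; tauto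
  have eT' : Tᶜ = insert i (S ∪ T)ᶜ := by
    ext k; have := hSe k
    simp only [Finset.mem_insert, Finset.mem_compl, Finset.mem_union]; tauto
  have kS : cubicCoeff p q S = linearMul (p i) (q i) (cubicCoeff p q (S ∩ T)) := by
    conv_lhs => rw [eS]
    exact cubicCoeff_insert_of_card_eq_two p q (by simp [hi'.2]) h
  have kT : cubicCoeff p q T = linearMul (p j) (q j) (cubicCoeff p q (S ∩ T)) := by
    conv_lhs => rw [eT]
    exact cubicCoeff_insert_of_card_eq_two p q (by simp [hj'.2]) h
  have kS' : cubicCoeff p q Sᶜ = linearMul (p j) (q j) (cubicCoeff p q (S ∪ T)ᶜ) := by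
    rw [eS']
    exact cubicCoeff_insert_of_card_eq_two p q (by simp [hj'.1]) h3
  have kT' : cubicCoeff p q Tᶜ = linearMul (p i) (q i) (cubicCoeff p q (S ∪ T)ᶜ) := by
    rw [eT']
    exact cubicCoeff_insert_of_card_eq_two p q (by simp [hi'.1]) h3
  rw [kS, kT, kS', kT']
  exact sum_dualCoeffs_mul_quadCoeffs_exchange _ _ _ _ _ _

theorem sum_dualCoeffs_eq_zero (p q : Fin 6 → ℂ) {S T : Finset (Fin 6)}
    (hS : S ∈ partitions) (hT : T ∈ partitions) (h : T ≠ S) :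
    ∑ k, quadCoeffs (cubicCoeff p q T) (cubicCoeff p q Tᶜ) k
      * dualCoeffs (cubicCoeff p q S) (cubicCoeff p q Sᶜ) k = 0 := by
  obtain ⟨hS3, hS0⟩ := mem_partitions.1 hS
  obtain ⟨hT3, hT0⟩ := mem_partitions.1 hT
  have h0 : 0 < (S ∩ T).card := Finset.card_pos.2 ⟨0, Finset.mem_inter.2 ⟨hS0, hT0⟩⟩
  have hle : (S ∩ T).card ≤ 3 := hS3 ▸ Finset.card_le_card Finset.inter_subset_left
  have hne : (S ∩ T).card ≠ 3 := fun hc => h <| by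
    have e1 := Finset.eq_of_subset_of_card_le (Finset.inter_subset_left (s₁ := S) (s₂ := T))
      (by omega)
    have e2 := Finset.eq_of_subset_of_card_le (Finset.inter_subset_right (s₁ := S) (s₂ := T))
      (by omega)
    exact e2.symm.trans e1
  by_cases h2 : (S ∩ T).card = 2
  · exact sum_dualCoeffs_eq_zero_of_card_inter p q hS3 hT3 h2
  -- Here `S` and `T` share only the index `0`, so `S` shares two indices with `Tᶜ`, which gives the
  -- same quadratic form.
  · have h3 := card_compl_of_mem_partitions hT
    have h4 : (S ∩ Tᶜ).card = 2 := by
      have := Finset.card_inter_add_card_sdiff S T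
      rw [Finset.sdiff_eq_inter_compl] at this
      omega
    have := sum_dualCoeffs_eq_zero_of_card_inter p q hS3 h3 h4
    rwa [compl_compl, quadCoeffs_symm] at this

theorem resultant_ne_zero {p q : Fin 6 → ℂ}
    (hdisc : ∀ i j, i ≠ j → p i * q j - p j * q i ≠ 0) (S : Finset (Fin 6)) :
    resultant p q S ≠ 0 :=
  Finset.prod_ne_zero_iff.2 fun i hi => Finset.prod_ne_zero_iff.2 fun j hj =>
    hdisc i j fun hij => Finset.mem_compl.1 hj (hij ▸ hi)

theorem sum_dualCoeffs_mul_yForm {p q : Fin 6 → ℂ}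
    (hdisc : ∀ i j, i ≠ j → p i * q j - p j * q i ≠ 0) (x : Fin 4 → ℂ) (k : Fin 10) :
    quadMonomials x k = ∑ S ∈ partitions,
      dualCoeffs (cubicCoeff p q S) (cubicCoeff p q Sᶜ) k / (4 * resultant p q S)
        * yForm p q S x := by
  let M : Matrix partitions (Fin 10) ℂ := fun S k =>
    quadCoeffs (cubicCoeff p q S.1) (cubicCoeff p q S.1ᶜ) k
  let N : Matrix (Fin 10) partitions ℂ := fun k S =>
    dualCoeffs (cubicCoeff p q S.1) (cubicCoeff p q S.1ᶜ) k / (4 * resultant p q S.1)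
  have hMN : M * N = 1 := by
    ext T S
    have e : (M * N) T S = (∑ k, quadCoeffs (cubicCoeff p q T.1) (cubicCoeff p q T.1ᶜ) k
        * dualCoeffs (cubicCoeff p q S.1) (cubicCoeff p q S.1ᶜ) k) / (4 * resultant p q S.1) := by
      rw [Matrix.mul_apply, Finset.sum_div]
      exact Finset.sum_congr rfl fun k _ => (mul_div_assoc _ _ _).symm
    rw [e]
    by_cases hTS : T = S
    · subst hTS
      rw [sum_dualCoeffs_mul_quadCoeffs_self p q T.2, Matrix.one_apply_eq,
        div_self (mul_ne_zero (by norm_num) (resultant_ne_zero hdisc _))]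
    · rw [sum_dualCoeffs_eq_zero p q S.2 T.2 fun h => hTS (Subtype.ext h),
        Matrix.one_apply_ne hTS, zero_div]
  have e : partitions ≃ Fin 10 := Fintype.equivFinOfCardEq (by simp [card_partitions])
  -- There are ten partitions and ten monomials, so the one-sided inverse given by apolarity is
  -- two-sided.
  have hNM : N * M = 1 := (Matrix.mul_eq_one_comm_of_equiv e).1 hMN
  have hy : ∀ S : partitions, yForm p q S.1 x = M.mulVec (quadMonomials x) S := fun S =>
    quadForm_eq_sum _ _ _
  rw [← Finset.sum_coe_sort]
  simp only [hy]
  change _ = N.mulVec (M.mulVec (quadMonomials x)) k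
  rw [Matrix.mulVec_mulVec, hNM, Matrix.one_mulVec]

theorem sq_eq_sum_aCoeff_mul_yForm {p q : Fin 6 → ℂ}
    (hdisc : ∀ i j, i ≠ j → p i * q j - p j * q i ≠ 0) (x : Fin 4 → ℂ) (i : Fin 4) :
    x i ^ 2 = ∑ S ∈ partitions, aCoeff p q i S * yForm p q S x := by
  have h := sum_dualCoeffs_mul_yForm hdisc x
  fin_cases i
  · exact h 0
  · exact h 1
  · exact h 2
  · exact h 3

/-! ### Kummer coordinates of points of the Jacobian -/

theorem CurvePoint.eq_or_eq_inv {f : Fin 7 → ℂ} {P Q : CurvePoint f}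
    (h : P.X * Q.Z - Q.X * P.Z = 0) : Q = P.inv ∨ P = Q := by
  have key : P.X = Q.X → P.Z = Q.Z → Q = P.inv ∨ P = Q := fun hX hZ => by
    have hY : P.Y ^ 2 = Q.Y ^ 2 := by rw [P.on_curve, Q.on_curve, hX, hZ]
    rcases sq_eq_sq_iff_eq_or_eq_neg.1 hY with hY | hY
    · exact Or.inr (CurvePoint.ext hX hY hZ)
    · exact Or.inl (CurvePoint.ext hX.symm (by simp [CurvePoint.inv, hY]) hZ.symm)
  rcases P.normalized with hP | ⟨hP, hP'⟩ <;> rcases Q.normalized with hQ | ⟨hQ, hQ'⟩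
  · rw [hP, hQ] at h
    exact key (by linear_combination h) (hP.trans hQ.symm)
  · rw [hP, hQ, hQ'] at h
    norm_num at h
  · rw [hP, hP', hQ] at h
    norm_num at h
  · exact key (hP.trans hQ.symm) (hP'.trans hQ'.symm)

theorem pairCoords_ne_zero {f : Fin 7 → ℂ} (P Q : CurvePoint f) : pairCoords P Q ≠ 0 := by
  unfold pairCoords
  intro h
  split_ifs at h with h1 h2
  · simpa using congrFun h 3
  · have e0 := congrFun h 0
    have e2 := congrFun h 2
    rcases P.normalized with hP | ⟨hP, -⟩
    · simp [hP] at e0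
    · simp [hP] at e2
  · have e0 := congrFun h 0
    have e1 := congrFun h 1
    have e2 := congrFun h 2
    rcases P.normalized with hP | ⟨hP, hP'⟩ <;> rcases Q.normalized with hQ | ⟨hQ, hQ'⟩
    · simp [hP, hQ] at e0
    · simp [hP, hQ, hQ'] at e1
    · simp [hP, hP', hQ] at e1
    · simp [hP, hQ] at e2

theorem kummerQuartic_pairCoords {f : Fin 7 → ℂ} (P Q : CurvePoint f) :
    kummerQuartic f (pairCoords P Q) = 0 := by
  unfold pairCoords
  split_ifs with h1 h2
  · simp [kummerQuartic, kummerConst]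
  · have hY : P.Y ≠ 0 := fun hY => h1 <| by
      rw [← h2]; exact CurvePoint.ext rfl (by simp [CurvePoint.inv, hY]) rfl
    have hc := P.on_curve
    simp only [sextic, Fin.sum_univ_succ, Fin.sum_univ_zero, Fin.val_zero, Fin.val_succ,
      Fin.succ_zero_eq_one, Fin.succ_one_eq_two, Fin.reduceSucc] at hc
    obtain ⟨z, hz⟩ : ∃ z, z = kummerConst f (P.Z ^ 2) (2 * P.X * P.Z) (P.X ^ 2) / (4 * P.Y ^ 2) :=
      ⟨_, rfl⟩
    rw [← hz]
    rw [eq_div_iff (by simpa using hY)] at hz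
    simp only [kummerQuartic, Matrix.cons_val]
    -- Here `x₂² = 4x₁x₃`, and the quartic reduces to `-4Y²x₄ + K₀` because `F₀` restricts to `2F`.
    linear_combination 4 * z * hc - hz
  · have hD : P.X * Q.Z - Q.X * P.Z ≠ 0 := fun h => by
      rcases CurvePoint.eq_or_eq_inv h with h | h
      · exact h1 h
      · exact h2 h
    have hP := P.on_curve
    have hQ := Q.on_curve
    simp only [sextic, Fin.sum_univ_succ, Fin.sum_univ_zero, Fin.val_zero, Fin.val_succ,
      Fin.succ_zero_eq_one, Fin.succ_one_eq_two, Fin.reduceSucc] at hP hQ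
    obtain ⟨z, hz⟩ : ∃ z, z = (polarForm f P.X P.Z Q.X Q.Z - 2 * P.Y * Q.Y)
      / (P.X * Q.Z - Q.X * P.Z) ^ 2 := ⟨_, rfl⟩
    rw [← hz]
    rw [eq_div_iff (pow_ne_zero 2 hD)] at hz
    simp only [kummerQuartic, kummerConst, Matrix.cons_val]
    refine (mul_eq_zero.1 ?_).resolve_left (pow_ne_zero 2 hD)
    have hPQ := congrArg₂ (· * ·) hP hQ
    -- With `Δ = X₁Z₂ - X₂Z₁`, the quartic times `Δ²` equals `(zΔ² - F₀)² - 4F(P)F(Q)`.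
    linear_combination (norm := skip) (z * (P.X * Q.Z - Q.X * P.Z) ^ 2
      - polarForm f P.X P.Z Q.X Q.Z - 2 * P.Y * Q.Y) * hz + 4 * hPQ
    simp only [polarForm]
    ring

theorem kummerCoords_mem {f : Fin 7 → ℂ} (P : Jacobian f) :
    kummerCoords P ≠ 0 ∧ kummerQuartic f (kummerCoords P) = 0 := by
  induction P using Quotient.inductionOn with | _ D
  induction D using Sym2.ind with | _ P Q
  exact ⟨pairCoords_ne_zero P Q, kummerQuartic_pairCoords P Q⟩

/-! ### The map `φ` and the sequence of bounds -/

theorem phi_mono (p q : Fin 6 → ℂ) {d d' : Fin 4 → ℝ} (h : ∀ j, d j ≤ d' j) (i : Fin 4) :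
    phi p q d i ≤ phi p q d' i := by
  refine Real.sqrt_le_sqrt (Finset.sum_le_sum fun S _ => ?_)
  refine mul_le_mul_of_nonneg_left (Real.sqrt_le_sqrt (Finset.sum_le_sum fun j _ => ?_))
    (norm_nonneg _)
  exact mul_le_mul_of_nonneg_left (h j) (norm_nonneg _)

/-- The two nested square roots turn `c ^ 4` into `c ^ 2` and then into `c`. -/
theorem phi_pow_four_mul (p q : Fin 6 → ℂ) {c : ℝ} (hc : 0 ≤ c) (d : Fin 4 → ℝ) (i : Fin 4) :
    phi p q (fun j => c ^ 4 * d j) i = c * phi p q d i := by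
  have h1 : ∀ S, Real.sqrt (∑ j, ‖bCoeff p q S j‖ * (c ^ 4 * d j))
      = c ^ 2 * Real.sqrt (∑ j, ‖bCoeff p q S j‖ * d j) := fun S => by
    rw [← Real.sqrt_sq (sq_nonneg c), ← Real.sqrt_mul (sq_nonneg _), Finset.mul_sum]
    congr 1
    exact Finset.sum_congr rfl fun j _ => by ring
  unfold phi
  simp only [h1]
  conv_rhs => rw [← Real.sqrt_sq hc, ← Real.sqrt_mul (sq_nonneg c), Finset.mul_sum]
  congr 1
  exact Finset.sum_congr rfl fun S _ => by ring

theorem norm_le_phi_of_sq {p q : Fin 6 → ℂ}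
    (hdisc : ∀ i j, i ≠ j → p i * q j - p j * q i ≠ 0) {x d : Fin 4 → ℂ}
    (h : ∀ S ∈ partitions, yForm p q S x ^ 2 = ∑ j, bCoeff p q S j * d j) (i : Fin 4) :
    ‖x i‖ ≤ phi p q (fun j => ‖d j‖) i := by
  refine Real.le_sqrt_of_sq_le ?_
  rw [← norm_pow, sq_eq_sum_aCoeff_mul_yForm hdisc x i]
  refine (norm_sum_le _ _).trans (Finset.sum_le_sum fun S hS => ?_)
  rw [norm_mul]
  refine mul_le_mul_of_nonneg_left (Real.le_sqrt_of_sq_le ?_) (norm_nonneg _)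
  rw [← norm_pow, h S hS]
  exact (norm_sum_le _ _).trans (Finset.sum_le_sum fun j _ => (norm_mul _ _).le)

theorem phi_pos {p q : Fin 6 → ℂ}
    (hdisc : ∀ i j, i ≠ j → p i * q j - p j * q i ≠ 0) {d : Fin 4 → ℝ} (hd : ∀ j, 0 < d j)
    (i : Fin 4) : 0 < phi p q d i := by
  -- If all coefficients vanished, the relation at `(1, 1, 1, 1)` would read `1 = 0`.
  obtain ⟨S, hS, ha⟩ : ∃ S ∈ partitions, aCoeff p q i S ≠ 0 := by
    by_contra! h
    have := sq_eq_sum_aCoeff_mul_yForm hdisc (fun _ => 1) i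
    rw [Finset.sum_eq_zero fun S hS => by rw [h S hS, zero_mul]] at this
    simp at this
  refine Real.sqrt_pos.2 (Finset.sum_pos' (fun _ _ => by positivity) ⟨S, hS, ?_⟩)
  refine mul_pos (norm_pos_iff.2 ha) (Real.sqrt_pos.2 (Finset.sum_pos'
    (fun j _ => mul_nonneg (norm_nonneg _) (hd j).le) ⟨3, Finset.mem_univ _, ?_⟩))
  simpa [bCoeff] using hd 3

theorem boundSeq_pos {p q : Fin 6 → ℂ}
    (hdisc : ∀ i j, i ≠ j → p i * q j - p j * q i ≠ 0) (n : ℕ) (i : Fin 4) :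
    0 < boundSeq p q n i := by
  induction n generalizing i with
  | zero => exact one_pos
  | succ n ih => exact phi_pos hdisc ih i

/-- Monotonicity and homogeneity turn `d ≤ eᵗ d'` into `φ(d) ≤ e^(t/4) φ(d')`. -/
theorem abs_log_phi_sub_le {p q : Fin 6 → ℂ}
    (hdisc : ∀ i j, i ≠ j → p i * q j - p j * q i ≠ 0) {d d' : Fin 4 → ℝ}
    (hd : ∀ j, 0 < d j) (hd' : ∀ j, 0 < d' j) {t : ℝ}
    (h : ∀ j, |Real.log (d j) - Real.log (d' j)| ≤ t) (i : Fin 4) :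
    |Real.log (phi p q d i) - Real.log (phi p q d' i)| ≤ t / 4 := by
  have key : ∀ {d d' : Fin 4 → ℝ}, (∀ j, 0 < d j) → (∀ j, 0 < d' j) →
      (∀ j, Real.log (d j) - Real.log (d' j) ≤ t) →
      Real.log (phi p q d i) - Real.log (phi p q d' i) ≤ t / 4 := by
    intro d d' hd hd' h
    have h1 : phi p q d i ≤ Real.exp (t / 4) * phi p q d' i := by
      rw [← phi_pow_four_mul p q (Real.exp_pos _).le]
      refine phi_mono p q (fun j => ?_) i
      rw [← Real.exp_nat_mul, ← Real.log_le_log_iff (hd j) (mul_pos (Real.exp_pos _) (hd' j)),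
        Real.log_mul (Real.exp_pos _).ne' (hd' j).ne', Real.log_exp]
      have := h j
      push_cast
      linarith
    have h2 := Real.log_le_log (phi_pos hdisc hd i) h1
    rw [Real.log_mul (Real.exp_pos _).ne' (phi_pos hdisc hd' i).ne', Real.log_exp] at h2
    linarith
  refine abs_le.2 ⟨?_, key hd hd' fun j => (abs_le.1 (h j)).2⟩
  have := key hd' hd fun j => by linarith [(abs_le.1 (h j)).1]
  linarith

theorem tendsto_boundSeq {p q : Fin 6 → ℂ}
    (hdisc : ∀ i j, i ≠ j → p i * q j - p j * q i ≠ 0) :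
    ∃ b : Fin 4 → ℝ, Tendsto (boundSeq p q) atTop (𝓝 b) ∧ ∀ i, 0 < b i := by
  set M := ∑ j, |Real.log (boundSeq p q 0 j) - Real.log (boundSeq p q 1 j)|
  have step : ∀ n i, |Real.log (boundSeq p q n i) - Real.log (boundSeq p q (n + 1) i)|
      ≤ M * (1 / 4) ^ n := by
    intro n
    induction n with
    | zero =>
      intro i
      rw [pow_zero, mul_one]
      exact Finset.single_le_sum
        (f := fun j => |Real.log (boundSeq p q 0 j) - Real.log (boundSeq p q 1 j)|)
        (fun _ _ => abs_nonneg _) (Finset.mem_univ i)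
    | succ n ih =>
      intro i
      have := abs_log_phi_sub_le hdisc (boundSeq_pos hdisc n) (boundSeq_pos hdisc (n + 1)) ih i
      rw [pow_succ]
      calc _ ≤ M * (1 / 4) ^ n / 4 := this
        _ = _ := by ring
  have lim : ∀ i, ∃ l, Tendsto (fun n => Real.log (boundSeq p q n i)) atTop (𝓝 l) := fun i =>
    cauchySeq_tendsto_of_complete
      (cauchySeq_of_le_geometric (1 / 4) M (by norm_num) fun n => step n i)
  choose l hl using lim
  refine ⟨fun i => Real.exp (l i), tendsto_pi_nhds.2 fun i => ?_, fun i => Real.exp_pos _⟩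
  refine ((Real.continuous_exp.tendsto _).comp (hl i)).congr fun n => ?_
  exact Real.exp_log (boundSeq_pos hdisc n i)

theorem norm_pos_of_forall_pos {b : Fin 4 → ℝ} (hb : ∀ i, 0 < b i) : 0 < ‖b‖ :=
  norm_pos_iff.2 fun h => (hb 0).ne' (congrFun h 0)

/-! ### Heights along the orbits of the duplication map -/

/-- The affine cone over the Kummer surface without its vertex. -/
def kummerCone (f : Fin 7 → ℂ) : Set (Fin 4 → ℂ) := {x | x ≠ 0 ∧ kummerQuartic f x = 0}

theorem dup_smul (f : Fin 7 → ℂ) (c : ℂ) (x : Fin 4 → ℂ) : dup f (c • x) = c ^ 4 • dup f x := by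
  simp only [dup, Pi.smul_apply, smul_eq_mul, Matrix.smul_cons, Matrix.smul_empty]
  congr 1
  · simp only [dup1, dupConst1]; ring
  congr 1
  · simp only [dup2, dupConst2]; ring
  congr 1
  · simp only [dup3, dupConst3]; ring
  congr 1
  simp only [dup4, dupConst4]; ring

theorem continuous_dup (f : Fin 7 → ℂ) : Continuous (dup f) := by
  have h1 : Continuous fun x : Fin 4 → ℂ =>
      dup1 (f 0) (f 1) (f 2) (f 3) (f 4) (f 5) (f 6) (x 0) (x 1) (x 2) (x 3) := by
    unfold dup1 dupConst1
    fun_prop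
  have h2 : Continuous fun x : Fin 4 → ℂ =>
      dup2 (f 0) (f 1) (f 2) (f 3) (f 4) (f 5) (f 6) (x 0) (x 1) (x 2) (x 3) := by
    unfold dup2 dupConst2
    fun_prop
  have h3 : Continuous fun x : Fin 4 → ℂ =>
      dup3 (f 0) (f 1) (f 2) (f 3) (f 4) (f 5) (f 6) (x 0) (x 1) (x 2) (x 3) := by
    unfold dup3 dupConst3
    fun_prop
  have h4 : Continuous fun x : Fin 4 → ℂ =>
      dup4 (f 0) (f 1) (f 2) (f 3) (f 4) (f 5) (f 6) (x 0) (x 1) (x 2) (x 3) := by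
    unfold dup4 dupConst4
    fun_prop
  refine continuous_pi fun i => ?_
  fin_cases i
  exacts [h1, h2, h3, h4]

theorem exists_norm_dup_le (f : Fin 7 → ℂ) : ∃ C : ℝ, 0 < C ∧ ∀ x, ‖dup f x‖ ≤ C * ‖x‖ ^ 4 := by
  obtain ⟨C, hC⟩ := (isCompact_sphere (0 : Fin 4 → ℂ) 1).exists_bound_of_continuousOn
    (continuous_dup f).continuousOn
  refine ⟨max C 1, lt_max_of_lt_right one_pos, fun x => ?_⟩
  by_cases hx : x = 0
  · have := dup_smul f 0 0
    subst hx
    simp at this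
    simp [this]
  have hn : (‖x‖ : ℂ) ≠ 0 := by simpa using hx
  have h := hC ((‖x‖ : ℂ)⁻¹ • x) (by simp [norm_smul, hx])
  have e : dup f x = (‖x‖ : ℂ) ^ 4 • dup f ((‖x‖ : ℂ)⁻¹ • x) := by
    rw [← dup_smul, smul_inv_smul₀ hn]
  rw [e, norm_smul, norm_pow, Complex.norm_real, norm_norm, mul_comm]
  exact mul_le_mul_of_nonneg_right (h.trans (le_max_left _ _)) (by positivity)

/-- If `δ(x) = 0`, all ten `y_S(x)` vanish, hence so do all `x i ^ 2`. -/
theorem dup_mem_kummerCone {f : Fin 7 → ℂ} {p q : Fin 6 → ℂ}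
    (hF : ∀ X Z : ℂ, sextic f X Z = ∏ i, (p i * X + q i * Z))
    (hdisc : ∀ i j, i ≠ j → p i * q j - p j * q i ≠ 0)
    {x : Fin 4 → ℂ} (hx : x ∈ kummerCone f) :
    dup f x ∈ kummerCone f := by
  refine ⟨fun h0 => hx.1 (funext fun i => ?_), kummerQuartic_dup hF hdisc hx.2⟩
  have h := sq_eq_sum_aCoeff_mul_yForm hdisc x i
  rw [Finset.sum_eq_zero fun S hS => ?_] at h
  · simpa using h
  have h2 := yForm_sq hF hx.2 hS
  rw [h0] at h2
  simp only [Pi.zero_apply, mul_zero, Finset.sum_const_zero] at h2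
  rw [pow_eq_zero_iff two_ne_zero] at h2
  rw [h2, mul_zero]

theorem iterate_dup_mem_kummerCone {f : Fin 7 → ℂ} {p q : Fin 6 → ℂ}
    (hF : ∀ X Z : ℂ, sextic f X Z = ∏ i, (p i * X + q i * Z))
    (hdisc : ∀ i j, i ≠ j → p i * q j - p j * q i ≠ 0)
    {x : Fin 4 → ℂ} (hx : x ∈ kummerCone f) (n : ℕ) :
    (dup f)^[n] x ∈ kummerCone f := by
  induction n with
  | zero => exact hx
  | succ n ih =>
    rw [Function.iterate_succ_apply']
    exact dup_mem_kummerCone hF hdisc ih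

theorem norm_le_mul_boundSeq {f : Fin 7 → ℂ} {p q : Fin 6 → ℂ}
    (hF : ∀ X Z : ℂ, sextic f X Z = ∏ i, (p i * X + q i * Z))
    (hdisc : ∀ i j, i ≠ j → p i * q j - p j * q i ≠ 0)
    {x : Fin 4 → ℂ} (hx : x ∈ kummerCone f) (N : ℕ) {r : ℝ}
    (hr : 0 ≤ r) (h : ∀ j, ‖(dup f)^[N] x j‖ ≤ r ^ 4 ^ N) (i : Fin 4) :
    ‖x i‖ ≤ r * boundSeq p q N i := by
  induction N generalizing x r i with
  | zero => simpa [boundSeq] using h i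
  | succ N ih =>
    -- Induction along the orbit: `δ(x)` is bounded with `r ^ 4` in place of `r`, and `φ` takes the
    -- fourth root back.
    have h1 := ih (dup_mem_kummerCone hF hdisc hx) (r := r ^ 4) (by positivity) fun j => by
      rw [← pow_mul, ← pow_succ']
      exact h j
    refine (norm_le_phi_of_sq hdisc (fun S hS => yForm_sq hF hx.2 hS) i).trans ?_
    refine (phi_mono p q h1 i).trans ?_
    rw [phi_pow_four_mul p q hr]
    rfl

theorem log_norm_sub_le {f : Fin 7 → ℂ} {p q : Fin 6 → ℂ}
    (hF : ∀ X Z : ℂ, sextic f X Z = ∏ i, (p i * X + q i * Z))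
    (hdisc : ∀ i j, i ≠ j → p i * q j - p j * q i ≠ 0)
    {x : Fin 4 → ℂ} (hx : x ∈ kummerCone f) (N : ℕ) :
    Real.log ‖x‖ - ((4 : ℝ) ^ N)⁻¹ * Real.log ‖(dup f)^[N] x‖ ≤ Real.log ‖boundSeq p q N‖ := by
  have hy : 0 < ‖(dup f)^[N] x‖ :=
    norm_pos_iff.2 (iterate_dup_mem_kummerCone hF hdisc hx N).1
  have hb := norm_pos_of_forall_pos (boundSeq_pos hdisc N)
  set r := ‖(dup f)^[N] x‖ ^ (((4 : ℝ) ^ N)⁻¹) with hrdef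
  have hr : 0 < r := Real.rpow_pos_of_pos hy _
  have hrp : r ^ 4 ^ N = ‖(dup f)^[N] x‖ := by
    have := Real.rpow_inv_natCast_pow hy.le (n := 4 ^ N) (by positivity)
    push_cast at this
    exact this
  have h1 : ‖x‖ ≤ r * ‖boundSeq p q N‖ := by
    refine (pi_norm_le_iff_of_nonneg (by positivity)).2 fun i => ?_
    refine (norm_le_mul_boundSeq hF hdisc hx N hr.le (fun j => ?_) i).trans ?_
    · rw [hrp]
      exact norm_le_pi_norm _ j
    · exact mul_le_mul_of_nonneg_left ((Real.le_norm_self _).trans (norm_le_pi_norm _ i)) hr.le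
  have h2 := Real.log_le_log (norm_pos_iff.2 hx.1) h1
  rw [Real.log_mul hr.ne' hb.ne', hrdef, Real.log_rpow hy] at h2
  linarith

/-! ### Telescoping, convergence and the supremum of the series -/

theorem sum_muTerm (f : Fin 7 → ℂ) (x : Fin 4 → ℂ) (N : ℕ) :
    ∑ n ∈ Finset.range N, muTerm f x n
      = Real.log ‖x‖ - ((4 : ℝ) ^ N)⁻¹ * Real.log ‖(dup f)^[N] x‖ := by
  induction N with
  | zero => simp
  | succ N ih =>
    rw [Finset.sum_range_succ, ih, muTerm, epsTilde, Function.iterate_succ_apply', pow_succ]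
    field_simp
    ring

theorem exists_abs_epsTilde_le {f : Fin 7 → ℂ} {p q : Fin 6 → ℂ}
    (hF : ∀ X Z : ℂ, sextic f X Z = ∏ i, (p i * X + q i * Z))
    (hdisc : ∀ i j, i ≠ j → p i * q j - p j * q i ≠ 0) :
    ∃ M : ℝ, ∀ x ∈ kummerCone f, |epsTilde f x| ≤ M := by
  obtain ⟨C, hC, hle⟩ := exists_norm_dup_le f
  -- The upper bound for `ε̃` is the case `N = 1` of `log_norm_sub_le`; the lower one comes from
  -- `‖δ(x)‖ ≤ C‖x‖⁴`.
  refine ⟨max (4 * Real.log ‖boundSeq p q 1‖) (Real.log C), fun x hx => abs_le'.2 ⟨?_, ?_⟩⟩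
  · refine le_trans ?_ (le_max_left _ _)
    have h := log_norm_sub_le hF hdisc hx 1
    rw [Function.iterate_one, pow_one] at h
    rw [epsTilde]
    linarith
  · refine le_trans ?_ (le_max_right _ _)
    have hx' := norm_pos_iff.2 hx.1
    have h := Real.log_le_log (norm_pos_iff.2 (dup_mem_kummerCone hF hdisc hx).1) (hle x)
    rw [Real.log_mul hC.ne' (by positivity), Real.log_pow] at h
    push_cast at h
    rw [epsTilde]
    linarith

theorem exists_abs_muTerm_le {f : Fin 7 → ℂ} {p q : Fin 6 → ℂ}
    (hF : ∀ X Z : ℂ, sextic f X Z = ∏ i, (p i * X + q i * Z))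
    (hdisc : ∀ i j, i ≠ j → p i * q j - p j * q i ≠ 0) :
    ∃ M : ℝ, ∀ x ∈ kummerCone f, ∀ n, ‖muTerm f x n‖ ≤ M * (1 / 4) ^ n := by
  obtain ⟨M, hM⟩ := exists_abs_epsTilde_le hF hdisc
  refine ⟨M, fun x hx n => ?_⟩
  have h := hM _ (iterate_dup_mem_kummerCone hF hdisc hx n)
  rw [muTerm, norm_mul, norm_inv, norm_pow, Real.norm_ofNat, Real.norm_eq_abs, mul_comm, one_div,
    inv_pow]
  refine mul_le_mul h ?_ (by positivity) ((abs_nonneg _).trans h)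
  exact inv_anti₀ (by positivity) (pow_le_pow_right₀ (by norm_num) n.le_succ)

theorem summable_muTerm {f : Fin 7 → ℂ} {p q : Fin 6 → ℂ}
    (hF : ∀ X Z : ℂ, sextic f X Z = ∏ i, (p i * X + q i * Z))
    (hdisc : ∀ i j, i ≠ j → p i * q j - p j * q i ≠ 0)
    {x : Fin 4 → ℂ} (hx : x ∈ kummerCone f) : Summable (muTerm f x) := by
  obtain ⟨M, hM⟩ := exists_abs_muTerm_le hF hdisc
  exact Summable.of_norm_bounded
    ((summable_geometric_of_lt_one (by norm_num) (by norm_num)).mul_left M) (hM x hx)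

theorem exists_tsum_muTerm_le {f : Fin 7 → ℂ} {p q : Fin 6 → ℂ}
    (hF : ∀ X Z : ℂ, sextic f X Z = ∏ i, (p i * X + q i * Z))
    (hdisc : ∀ i j, i ≠ j → p i * q j - p j * q i ≠ 0) :
    ∃ C : ℝ, ∀ x ∈ kummerCone f, ∑' n, muTerm f x n ≤ C := by
  obtain ⟨M, hM⟩ := exists_abs_muTerm_le hF hdisc
  have hs : Summable fun n : ℕ => M * (1 / 4 : ℝ) ^ n :=
    (summable_geometric_of_lt_one (by norm_num) (by norm_num)).mul_left M
  exact ⟨_, fun x hx => Summable.tsum_le_tsum (fun n => (Real.le_norm_self _).trans (hM x hx n))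
    (summable_muTerm hF hdisc hx) hs⟩

theorem tsum_muTerm_eq {f : Fin 7 → ℂ} {p q : Fin 6 → ℂ}
    (hF : ∀ X Z : ℂ, sextic f X Z = ∏ i, (p i * X + q i * Z))
    (hdisc : ∀ i j, i ≠ j → p i * q j - p j * q i ≠ 0)
    {x : Fin 4 → ℂ} (hx : x ∈ kummerCone f) (N : ℕ) :
    ∑' n, muTerm f x n = Real.log ‖x‖ - ((4 : ℝ) ^ N)⁻¹ * Real.log ‖(dup f)^[N] x‖
      + ((4 : ℝ) ^ N)⁻¹ * ∑' n, muTerm f ((dup f)^[N] x) n := by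
  rw [← sum_muTerm, ← (summable_muTerm hF hdisc hx).sum_add_tsum_nat_add N, ← tsum_mul_left]
  congr 2
  funext n
  rw [muTerm, muTerm, ← Function.iterate_add_apply, add_right_comm, pow_add]
  field_simp

theorem tsum_muTerm_le {f : Fin 7 → ℂ} {p q : Fin 6 → ℂ}
    (hF : ∀ X Z : ℂ, sextic f X Z = ∏ i, (p i * X + q i * Z))
    (hdisc : ∀ i j, i ≠ j → p i * q j - p j * q i ≠ 0)
    {x : Fin 4 → ℂ} (hx : x ∈ kummerCone f) {N : ℕ} (hN : 1 ≤ N) :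
    ∑' n, muTerm f x n ≤ (4 : ℝ) ^ N / (4 ^ N - 1) * Real.log ‖boundSeq p q N‖ := by
  obtain ⟨C, hC⟩ := exists_tsum_muTerm_le hF hdisc
  -- The supremum is taken over the whole cone, which is stable under `δ`; it is not needed that `δ`
  -- of Kummer coordinates again comes from a point of the Jacobian.
  set V := (fun x => ∑' n, muTerm f x n) '' kummerCone f
  have hbdd : BddAbove V := ⟨C, by rintro _ ⟨y, hy, rfl⟩; exact hC y hy⟩
  have hN4 : (1 : ℝ) < 4 ^ N := one_lt_pow₀ (by norm_num) (by omega)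
  have hle : ∀ y ∈ kummerCone f, ∑' n, muTerm f y n
      ≤ Real.log ‖boundSeq p q N‖ + ((4 : ℝ) ^ N)⁻¹ * sSup V := fun y hy => by
    rw [tsum_muTerm_eq hF hdisc hy N]
    refine add_le_add (log_norm_sub_le hF hdisc hy N)
      (mul_le_mul_of_nonneg_left (le_csSup hbdd ?_) (by positivity))
    exact ⟨_, iterate_dup_mem_kummerCone hF hdisc hy N, rfl⟩
  have hsup : sSup V ≤ Real.log ‖boundSeq p q N‖ + ((4 : ℝ) ^ N)⁻¹ * sSup V :=
    csSup_le ⟨_, x, hx, rfl⟩ (by rintro _ ⟨y, hy, rfl⟩; exact hle y hy)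
  refine (le_csSup hbdd ⟨x, hx, rfl⟩).trans ?_
  rw [div_mul_eq_mul_div, le_div_iff₀ (by linarith)]
  have h1 := mul_le_mul_of_nonneg_left hsup (by positivity : (0 : ℝ) ≤ 4 ^ N)
  rw [mul_add, ← mul_assoc, mul_inv_cancel₀ (by positivity), one_mul] at h1
  linarith

/-- The final bound on `sSup` requires a nonempty range, since `sSup ∅ = 0` could exceed `log ‖b‖`.
-/
theorem jacobian_nonempty (f : Fin 7 → ℂ) : Nonempty (Jacobian f) := by
  obtain ⟨Y, hY⟩ := IsAlgClosed.exists_pow_nat_eq (sextic f 0 1) two_pos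
  let P : CurvePoint f := ⟨0, Y, 1, hY, Or.inl rfl⟩
  exact ⟨Quotient.mk (linearEquivalence f) s(P, P)⟩

end Genus2

end

theorem lemmaL (f : Fin 7 → ℂ) (p q : Fin 6 → ℂ)
    (hF : ∀ X Z : ℂ, Genus2.sextic f X Z = ∏ i, (p i * X + q i * Z))
    (hdisc : ∀ i j, i ≠ j → p i * q j - p j * q i ≠ 0) :
    -- the numbers `a` and `b` are the coefficients in the two relations that define them
    (∀ (x : Fin 4 → ℂ) (i : Fin 4),
      x i ^ 2 = ∑ S ∈ Genus2.partitions, Genus2.aCoeff p q i S * Genus2.yForm p q S x) ∧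
    (∀ (P : Genus2.Jacobian f), ∀ S ∈ Genus2.partitions,
      Genus2.yForm p q S (Genus2.kummerCoords P) ^ 2 =
        ∑ j, Genus2.bCoeff p q S j * Genus2.dup f (Genus2.kummerCoords P) j) ∧
    -- the series defining `μ̃` converges on `J(ℂ)`
    (∀ P : Genus2.Jacobian f, Summable (Genus2.muTerm f (Genus2.kummerCoords P))) ∧
    -- the bounds
    ∃ b : Fin 4 → ℝ,
      Tendsto (Genus2.boundSeq p q) atTop (𝓝 b) ∧
      (∀ i, 0 < b i) ∧
      (∀ N : ℕ, 1 ≤ N → 0 < ‖Genus2.boundSeq p q N‖ ∧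
        ∀ P : Genus2.Jacobian f,
          Genus2.muTilde P ≤ (4 : ℝ) ^ N / (4 ^ N - 1) * Real.log ‖Genus2.boundSeq p q N‖) ∧
      BddAbove (Set.range (Genus2.muTilde (f := f))) ∧
      sSup (Set.range (Genus2.muTilde (f := f))) ≤ Real.log ‖b‖ := by
  have hmem : ∀ P : Genus2.Jacobian f, Genus2.kummerCoords P ∈ Genus2.kummerCone f :=
    Genus2.kummerCoords_mem
  obtain ⟨b, hb, hbpos⟩ := Genus2.tendsto_boundSeq hdisc
  have hlim : Tendsto
      (fun N : ℕ => (4 : ℝ) ^ N / (4 ^ N - 1) * Real.log ‖Genus2.boundSeq p q N‖) atTop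
      (𝓝 (Real.log ‖b‖)) := by
    have h1 : Tendsto (fun N : ℕ => (4 : ℝ) ^ N / (4 ^ N - 1)) atTop (𝓝 1) := by
      have h0 : Tendsto (fun N : ℕ => (1 - (1 / 4 : ℝ) ^ N)⁻¹) atTop (𝓝 (1 - 0)⁻¹) :=
        ((tendsto_pow_atTop_nhds_zero_of_lt_one (by norm_num) (by norm_num)).const_sub 1).inv₀
          (by norm_num)
      rw [sub_zero, inv_one] at h0
      refine h0.congr fun N => ?_
      have h4 : (4 : ℝ) ^ N ≠ 0 := by positivity
      have h5 : (4 : ℝ) ^ N / (4 ^ N - 1) = ((4 ^ N - 1) / 4 ^ N)⁻¹ := (inv_div _ _).symm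
      rw [h5, sub_div, div_self h4, one_div_pow]
    have h2 := (Real.continuousAt_log
      (Genus2.norm_pos_of_forall_pos hbpos).ne').tendsto.comp hb.norm
    simpa using h1.mul h2
  have hle : ∀ P : Genus2.Jacobian f, Genus2.muTilde P ≤ Real.log ‖b‖ := fun P =>
    ge_of_tendsto hlim ((eventually_ge_atTop 1).mono fun N hN =>
      Genus2.tsum_muTerm_le hF hdisc (hmem P) hN)
  refine ⟨Genus2.sq_eq_sum_aCoeff_mul_yForm hdisc,
    fun P S hS => Genus2.yForm_sq hF (hmem P).2 hS,
    fun P => Genus2.summable_muTerm hF hdisc (hmem P), b, hb, hbpos, fun N hN =>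
    ⟨Genus2.norm_pos_of_forall_pos (Genus2.boundSeq_pos hdisc N), fun P =>
      Genus2.tsum_muTerm_le hF hdisc (hmem P) hN⟩,
    ⟨_, Set.forall_mem_range.2 hle⟩, ?_⟩
  have := Genus2.jacobian_nonempty f
  exact csSup_le (Set.range_nonempty _) (Set.forall_mem_range.2 hle)
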